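/- For integers $n\ge 1$, let $X_n$ be a random matrix from the Laguerre Unitary Ensemble with parameter $\alpha=n$, that is, distributed on the cone $\mathcal P_n$ of nonnegative $n\times n$ complex Hermitian matrices according to $$d\mathbb P(X)=\frac1Z(\det X)^{n}\,e^{-\operatorname{Tr}X}\,dX,$$ where $dX$ is Lebesgue measure on the $n^2$-dimensional real space of Hermitian matrices and $Z$ is the normalizing constant. For an integer $k\ge 0$ set $\tau_k(n)=n^{k-1}\operatorname{Tr}X_n^{-k}$. Then for every integer $k\ge 0$ there are nonnegative integers $\kappa_g(k)$, $g=0,1,2,\dots$, not depending on $n$, such that for all integers $n\ge \max(k,1)$ the random variable $\tau_k(n)$ is integrable and $$\mathbb E\,\tau_k(n)=\sum_{g=0}^{\infty}\kappa_g(k)\,n^{-g},$$ the series being convergent. Moreover $\kappa_g(k)=0$ for all odd $g$, so that the expansion is in powers of $n^{-2}$. If $k\ge 2$, then $\kappa_g(k)$ is a positive integer for every even $g$; if $k\in\{0,1\}$, then $\kappa_0(k)=1$ and $\kappa_g(k)=0$ for all $g\ge1$. -/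

import Mathlib

open MeasureTheory
open scoped ComplexOrder

noncomputable section

/-- Complex matrices carry the product (that is, the Borel) sigma-algebra. -/
instance complexMatrixMeasurableSpace (n : ℕ) : MeasurableSpace (Matrix (Fin n) (Fin n) ℂ) :=
  inferInstanceAs (MeasurableSpace (Fin n → Fin n → ℂ))

/-- The Hermitian matrix with real coordinates `x`: the diagonal entries are `x i i`, and for
`i < j` the `(i, j)` entry is `x i j + √(-1) * x j i`. This is the usual linear identification of
`ℝ ^ (n ^ 2)` with the space of `n × n` Hermitian matrices. -/
def hermitianOfCoords (n : ℕ) (x : Fin n → Fin n → ℝ) : Matrix (Fin n) (Fin n) ℂ :=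
  Matrix.of fun i j =>
    if i < j then ⟨x i j, x j i⟩
    else if j < i then ⟨x j i, -x i j⟩
    else ⟨x i i, 0⟩

theorem hermitianOfCoords_isHermitian (n : ℕ) (x : Fin n → Fin n → ℝ) :
    (hermitianOfCoords n x).IsHermitian := by
  ext i j
  rcases lt_trichotomy i j with h | h | h
  · simp [hermitianOfCoords, Matrix.conjTranspose_apply, h, h.not_gt, Complex.ext_iff]
  · subst h
    simp [hermitianOfCoords, Matrix.conjTranspose_apply, Complex.ext_iff]
  · simp [hermitianOfCoords, Matrix.conjTranspose_apply, h, h.not_gt, Complex.ext_iff]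

/-- Lebesgue measure `dX = ∏ᵢ dXᵢᵢ ∏_{i<j} d(Re Xᵢⱼ) d(Im Xᵢⱼ)` on the Hermitian matrices, as a
measure on all complex matrices. -/
def hermitianLebesgue (n : ℕ) : Measure (Matrix (Fin n) (Fin n) ℂ) :=
  Measure.map (hermitianOfCoords n) (volume : Measure (Fin n → Fin n → ℝ))

theorem measurable_hermitianOfCoords (n : ℕ) : Measurable (hermitianOfCoords n) := by
  refine measurable_pi_lambda _ fun i => measurable_pi_lambda _ fun j => ?_
  have key : ∀ a b : (Fin n → Fin n → ℝ) → ℝ, Measurable a → Measurable b →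
      Measurable fun x => (⟨a x, b x⟩ : ℂ) := fun a b ha hb =>
    Complex.measurableEquivRealProd.symm.measurable.comp (ha.prodMk hb)
  unfold hermitianOfCoords
  simp only [Matrix.of_apply]
  split_ifs
  · exact key _ _ (by fun_prop) (by fun_prop)
  · exact key _ _ (by fun_prop) (by fun_prop)
  · exact key _ _ (by fun_prop) (by fun_prop)

/-- The unnormalised Laguerre measure `(det X) ^ α * exp (-Tr X) dX` on the cone of nonnegative
Hermitian matrices (on which determinant and trace are real). -/
def lueWeight (n α : ℕ) : Measure (Matrix (Fin n) (Fin n) ℂ) :=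
  ((hermitianLebesgue n).restrict {X | X.PosSemidef}).withDensity fun X =>
    ENNReal.ofReal (X.det.re ^ α * Real.exp (-X.trace.re))

/-- The Laguerre Unitary Ensemble of `n × n` matrices with parameter `α`: the law
`Z⁻¹ (det X) ^ α exp (-Tr X) dX`, where `Z` is the total mass of the unnormalised measure. -/
def LUE (n α : ℕ) : Measure (Matrix (Fin n) (Fin n) ℂ) :=
  (lueWeight n α Set.univ)⁻¹ • lueWeight n α

/-- The rescaled inverse power trace `τ_k(n) = n ^ (k - 1) * Tr X ^ (-k)`; the trace is real for
Hermitian `X`. -/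
def inversePowerTrace (n k : ℕ) (X : Matrix (Fin n) (Fin n) ℂ) : ℝ :=
  (n : ℝ) ^ ((k : ℤ) - 1) * ((X⁻¹ ^ k).trace).re

end

/-!
The expansion follows from the loop equations for inverse moments. Put `Y = X⁻¹` and, for a list `l`
of positive integers with sum `d`, let `W l` be the expectation of `∏ b ∈ l, Tr Y ^ b`. Integrating
the divergence of the matrix field `Y ^ a • P_μ(Y) • (det X) ^ n * exp (-Tr X)`, with
`P_μ(Y) = ∏ b ∈ μ, Tr Y ^ b`, over the cone gives (`inverseMoment_loop`)

  `n * W ((a + 1) :: μ) = W (a :: μ) + J W ((a + 1) :: μ)`,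

where `W (0 :: μ) = n * W μ` and `J` is the cut-and-join operator (`cutJoin`): it sums over the ways
in which a transposition cuts the first cycle or joins it to another one. There is no boundary term
as long as the degree `a + 1 + μ.sum` is at most `n`, because then the field is `O(det X)` at the
boundary of the cone (`setIntegral_lineDeriv_eq_zero`).

All signs in the loop equation are positive, and `J` has `d - 1` terms in degree `d`. For `d ≤ n` the
operator `n⁻¹ • J` is therefore a contraction, and solving for `W` by a geometric series in
`n⁻¹ • J`, one degree at a time, yields a convergent series in `n⁻¹` whose coefficients
(`genusCoeff`) are natural numbers not depending on `n` (`hasSum_genusCoeff`). The coefficients count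
factorisations into transpositions, so a parity argument (`genusCoeff_ne_zero`) shows that for the
one-cycle list `[k]` only the powers `n⁻¹ ^ (k - 1 + 2 * h)` occur; the factor `n ^ (k - 1)` turns
these into powers of `n⁻¹ ^ 2`. Positivity for `k ≥ 2` descends to `k = 2`, where multiplication by
the transposition exchanges the cycle types `[2]` and `[1, 1]` (`genusCoeff_single_pos`).
-/

/-! ### Cut-and-join recursion and its coefficients -/

/-- The cut-and-join operator on functions of lists of cycle lengths. It sums `f` over the cycle
types reached from a permutation with cycles `(a + 1) :: μ` by multiplying with the transpositions
that involve a chosen element of the first cycle: such a transposition cuts the first cycle in two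
or joins it to another one. The value is `0` on lists with no nonempty first cycle. -/
def cutJoin {R : Type*} [Semiring R] (f : List ℕ → R) : List ℕ → R
  | [] => 0
  | 0 :: _ => 0
  | (a + 1) :: μ =>
      ∑ m ∈ Finset.range a, f ((m + 1) :: (a - m) :: μ) +
        ∑ j : Fin μ.length, (μ[j] : R) * f ((a + 1 + μ[j]) :: μ.eraseIdx j)

/-- Coefficient of `n⁻¹ ^ g` in the part of the loop equation for `l` that lowers the first cycle,
`prev` being the coefficients in the preceding degree. Removing a fixed point contributes a factor
`n * n⁻¹ = 1`, and shortening a longer cycle a factor `n⁻¹`. -/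
def genusSource (prev : ℕ → List ℕ → ℕ) : ℕ → List ℕ → ℕ
  | g, 1 :: μ => prev g μ
  | g + 1, (a + 2) :: μ => prev g ((a + 1) :: μ)
  | _, _ => 0

/-- The coefficients in one degree, given those `prev` of the preceding degree: each application of
the cut-and-join operator costs one power of `n⁻¹`. -/
def genusCoeffStep (prev : ℕ → List ℕ → ℕ) : ℕ → List ℕ → ℕ
  | 0, l => genusSource prev 0 l
  | g + 1, l => genusSource prev (g + 1) l + cutJoin (genusCoeffStep prev g) l

/-- The coefficient of `n⁻¹ ^ g` in the expectation of `∏ b ∈ l, Tr X ^ (-b)`, for a list `l` of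
positive integers with sum `d`; it is a natural number by construction. -/
def genusCoeff : ℕ → ℕ → List ℕ → ℕ
  | 0 => fun g _ => if g = 0 then 1 else 0
  | d + 1 => genusCoeffStep (genusCoeff d)

/-- `l` is a list of positive integers with sum `d`. -/
def IsCompositionOf (d : ℕ) (l : List ℕ) : Prop := (∀ b ∈ l, 0 < b) ∧ l.sum = d

theorem sum_eraseIdx_add_getElem (μ : List ℕ) (j : ℕ) (hj : j < μ.length) :
    μ[j] + (μ.eraseIdx j).sum = μ.sum := by
  rw [← List.sum_cons]
  exact (List.getElem_cons_eraseIdx_perm hj).sum_eq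

theorem IsCompositionOf.cut {d a m : ℕ} {μ : List ℕ} (h : IsCompositionOf d ((a + 1) :: μ))
    (hm : m < a) : IsCompositionOf d ((m + 1) :: (a - m) :: μ) := by
  refine ⟨?_, ?_⟩
  · intro b hb
    simp only [List.mem_cons] at hb
    rcases hb with rfl | rfl | hb
    · omega
    · omega
    · exact h.1 b (by simp [hb])
  · have := h.2
    simp only [List.sum_cons] at this ⊢
    omega

theorem IsCompositionOf.join {d a : ℕ} {μ : List ℕ} (h : IsCompositionOf d ((a + 1) :: μ))
    (j : Fin μ.length) : IsCompositionOf d ((a + 1 + μ[j]) :: μ.eraseIdx j) := by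
  refine ⟨?_, ?_⟩
  · intro b hb
    simp only [List.mem_cons] at hb
    rcases hb with rfl | hb
    · omega
    · exact h.1 b (by simp [List.mem_of_mem_eraseIdx hb])
  · have := h.2
    have h2 := sum_eraseIdx_add_getElem μ j j.2
    simp only [List.sum_cons, Fin.getElem_fin] at this ⊢
    omega

theorem exists_bound_on_compositions (d : ℕ) (f : List ℕ → ℝ) :
    ∃ M, 0 ≤ M ∧ ∀ l, IsCompositionOf d l → |f l| ≤ M := by
  refine ⟨∑ c : Composition d, |f c.blocks|, by positivity, fun l hl => ?_⟩
  exact Finset.single_le_sum (f := fun c : Composition d => |f c.blocks|) (fun _ _ => abs_nonneg _)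
    (Finset.mem_univ (⟨l, fun {i} hi => hl.1 i hi, hl.2⟩ : Composition d))

/-- Counted with multiplicity, the cut-and-join operator has `d` terms on compositions of
`d + 1`. -/
theorem abs_cutJoin_le {d : ℕ} {f : List ℕ → ℝ} {M : ℝ}
    (hf : ∀ l, IsCompositionOf (d + 1) l → |f l| ≤ M) {l : List ℕ}
    (hl : IsCompositionOf (d + 1) l) : |cutJoin f l| ≤ d * M := by
  match l, hl with
  | [], hl => simp [IsCompositionOf] at hl
  | 0 :: μ, hl => simpa using hl.1 0
  | (a + 1) :: μ, hl =>
    have hd : a + μ.sum = d := by have := hl.2; simp at this; omega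
    have hsum : ∑ j : Fin μ.length, (μ[j] : ℝ) = (μ.sum : ℝ) := by
      rw [← Nat.cast_sum]; congr 1; exact Fin.sum_univ_getElem μ
    calc |cutJoin f ((a + 1) :: μ)|
        ≤ ∑ m ∈ Finset.range a, |f ((m + 1) :: (a - m) :: μ)| +
          ∑ j : Fin μ.length, |(μ[j] : ℝ) * f ((a + 1 + μ[j]) :: μ.eraseIdx j)| :=
          (abs_add_le _ _).trans (add_le_add (Finset.abs_sum_le_sum_abs _ _)
            (Finset.abs_sum_le_sum_abs _ _))
      _ ≤ ∑ m ∈ Finset.range a, M + ∑ j : Fin μ.length, (μ[j] : ℝ) * M := by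
          refine add_le_add (Finset.sum_le_sum fun m hm => hf _ (hl.cut (Finset.mem_range.1 hm)))
            (Finset.sum_le_sum fun j _ => ?_)
          rw [abs_mul, Nat.abs_cast]
          exact mul_le_mul_of_nonneg_left (hf _ (hl.join j)) (Nat.cast_nonneg _)
      _ = d * M := by
          rw [← Finset.sum_mul, hsum, ← hd]; simp; ring

theorem cutJoin_sub (f g : List ℕ → ℝ) (l : List ℕ) :
    cutJoin (fun l => f l - g l) l = cutJoin f l - cutJoin g l := by
  match l with
  | [] => simp [cutJoin]
  | 0 :: μ => simp [cutJoin]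
  | (a + 1) :: μ => simp only [cutJoin, mul_sub, Finset.sum_sub_distrib]; ring

theorem map_cutJoin {R S : Type*} [Semiring R] [Semiring S] (φ : R →+ S) (f : List ℕ → R)
    (l : List ℕ) : φ (cutJoin f l) = cutJoin (fun l => φ (f l)) l := by
  match l with
  | [] => simp [cutJoin]
  | 0 :: μ => simp [cutJoin]
  | (a + 1) :: μ => simp only [cutJoin, map_add, map_sum, ← nsmul_eq_mul, map_nsmul]

theorem cutJoin_natCast_mul (f : List ℕ → ℕ) (c : ℝ) (l : List ℕ) :
    cutJoin (fun l => (f l : ℝ) * c) l = (cutJoin f l : ℕ) * c :=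
  (map_cutJoin ((AddMonoidHom.mulRight c).comp (Nat.castAddMonoidHom ℝ)) f l).symm

theorem hasSum_cutJoin {d : ℕ} {F : ℕ → List ℕ → ℝ} {T : List ℕ → ℝ}
    (hF : ∀ l, IsCompositionOf d l → HasSum (fun g => F g l) (T l)) {l : List ℕ}
    (hl : IsCompositionOf d l) : HasSum (fun g => cutJoin (F g) l) (cutJoin T l) := by
  match l, hl with
  | [], hl => simp [cutJoin]
  | 0 :: μ, hl => simp [cutJoin]
  | (a + 1) :: μ, hl =>
    exact (hasSum_sum fun m hm => hF _ (hl.cut (Finset.mem_range.1 hm))).add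
      (hasSum_sum fun j _ => (hF _ (hl.join j)).mul_left _)

theorem sum_range_cutJoin {F : ℕ → List ℕ → ℝ} (N : ℕ) (l : List ℕ) :
    ∑ g ∈ Finset.range N, cutJoin (F g) l = cutJoin (fun l => ∑ g ∈ Finset.range N, F g l) l := by
  match l with
  | [] => simp [cutJoin]
  | 0 :: μ => simp [cutJoin]
  | (a + 1) :: μ =>
    simp only [cutJoin, Finset.sum_add_distrib, Finset.mul_sum]
    rw [Finset.sum_comm, Finset.sum_comm (s := Finset.range N) (t := Finset.univ)]

/-- A solution of the fixed point equation `W = V + x J W` on compositions of `d + 1`, with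
`x d < 1`, has the expansion obtained by expanding `V` and iterating. -/
theorem hasSum_of_cutJoin_fixedPoint {d : ℕ} {x : ℝ} (hx : 0 ≤ x) (hxd : d * x < 1)
    {v c : ℕ → List ℕ → ℕ} {V W : List ℕ → ℝ}
    (hv : ∀ l, IsCompositionOf (d + 1) l → HasSum (fun g => (v g l : ℝ) * x ^ g) (V l))
    (hW : ∀ l, IsCompositionOf (d + 1) l → W l = V l + x * cutJoin W l)
    (hc0 : ∀ l, c 0 l = v 0 l) (hc : ∀ g l, c (g + 1) l = v (g + 1) l + cutJoin (c g) l)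
    {l : List ℕ} (hl : IsCompositionOf (d + 1) l) :
    HasSum (fun g => (c g l : ℝ) * x ^ g) (W l) := by
  have hρ : 0 < 1 - d * x := by linarith
  have hcx : ∀ g l, (c (g + 1) l : ℝ) * x ^ (g + 1) = (v (g + 1) l : ℝ) * x ^ (g + 1) +
      x * cutJoin (fun l => (c g l : ℝ) * x ^ g) l := by
    intro g l
    rw [cutJoin_natCast_mul, hc]; push_cast; ring
  -- The bound `B / (1 - d * x)` is the fixed point of `M ↦ B + x * (d * M)`, hence it propagates
  -- through the recursion for the partial sums.
  obtain ⟨B, hB0, hB⟩ := exists_bound_on_compositions (d + 1) V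
  have hM : B + x * (d * (B / (1 - d * x))) = B / (1 - d * x) := by
    have := hρ.ne'
    rw [eq_div_iff this, add_mul]
    field_simp
    ring
  have hM0 : 0 ≤ B / (1 - d * x) := by positivity
  have hbound : ∀ N l, IsCompositionOf (d + 1) l →
      |∑ g ∈ Finset.range N, (c g l : ℝ) * x ^ g| ≤ B / (1 - d * x) := by
    intro N
    induction N with
    | zero => intro l _; simpa using hM0
    | succ N ih =>
      intro l hl
      have hsplit : ∑ g ∈ Finset.range (N + 1), (c g l : ℝ) * x ^ g =
          ∑ g ∈ Finset.range (N + 1), (v g l : ℝ) * x ^ g +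
            x * cutJoin (fun l => ∑ g ∈ Finset.range N, (c g l : ℝ) * x ^ g) l := by
        rw [Finset.sum_range_succ', Finset.sum_range_succ' _ N, ← sum_range_cutJoin,
          Finset.mul_sum]
        simp only [hcx, Finset.sum_add_distrib, hc0]
        ring
      rw [hsplit, ← hM]
      refine (abs_add_le _ _).trans (add_le_add ?_ ?_)
      · have h0 : ∀ g, 0 ≤ (v g l : ℝ) * x ^ g := fun g => by positivity
        rw [abs_of_nonneg (Finset.sum_nonneg fun g _ => h0 g)]
        exact (sum_le_hasSum _ (fun g _ => h0 g) (hv l hl)).trans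
          ((le_abs_self _).trans (hB l hl))
      · rw [abs_mul, abs_of_nonneg hx]
        exact mul_le_mul_of_nonneg_left (abs_cutJoin_le ih hl) hx
  have hsummable : ∀ l, IsCompositionOf (d + 1) l → Summable fun g => (c g l : ℝ) * x ^ g :=
    fun l hl => summable_of_sum_range_le (fun g => by positivity)
      fun N => (le_abs_self _).trans (hbound N l hl)
  set T : List ℕ → ℝ := fun l => ∑' g, (c g l : ℝ) * x ^ g with hTdef
  have hT : ∀ l, IsCompositionOf (d + 1) l → T l = V l + x * cutJoin T l := by
    intro l hl
    have h1 := hasSum_cutJoin (F := fun g l => (c g l : ℝ) * x ^ g)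
      (fun l hl => (hsummable l hl).hasSum) hl
    have h2 := ((hasSum_nat_add_iff' 1).2 (hv l hl)).add (h1.mul_left x)
    simp only [← hcx] at h2
    have h4 := (hasSum_nat_add_iff (f := fun g => (c g l : ℝ) * x ^ g) 1).1 h2
    have := h4.tsum_eq
    simp only [Finset.sum_range_one, hc0] at this
    rw [hTdef]
    linarith
  -- `W` and the sum `T` solve the same equation, whose homogeneous part is a contraction.
  have hD : ∀ l, IsCompositionOf (d + 1) l →
      W l - T l = x * cutJoin (fun l => W l - T l) l := by
    intro l hl
    rw [cutJoin_sub, hW l hl, hT l hl]; ring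
  obtain ⟨M, hM0, hM⟩ := exists_bound_on_compositions (d + 1) fun l => W l - T l
  have hpow : ∀ m l, IsCompositionOf (d + 1) l → |W l - T l| ≤ (d * x) ^ m * M := by
    intro m
    induction m with
    | zero => simpa using hM
    | succ m ih =>
      intro l hl
      rw [hD l hl, abs_mul, abs_of_nonneg hx]
      refine (mul_le_mul_of_nonneg_left (abs_cutJoin_le ih hl) hx).trans (le_of_eq ?_)
      ring
  have hlim : Filter.Tendsto (fun m : ℕ => (d * x) ^ m * M) Filter.atTop (nhds 0) := by
    simpa using (tendsto_pow_atTop_nhds_zero_of_lt_one (by positivity) hxd).mul_const M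
  have h0 : |W l - T l| ≤ 0 := ge_of_tendsto' hlim fun m => hpow m l hl
  have : W l = T l := by simpa [sub_eq_zero] using h0
  rw [this]
  exact (hsummable l hl).hasSum

/-- A function satisfying the loop equations up to degree `n` is the sum of the series with
coefficients `genusCoeff`. The restriction `d ≤ n` makes `n⁻¹ • cutJoin` a contraction in degree
`d`. -/
theorem hasSum_genusCoeff {n : ℕ} {W : List ℕ → ℝ} (h0 : W [] = 1)
    (hW : ∀ a μ, a + 1 + μ.sum ≤ n → (n : ℝ) * W ((a + 1) :: μ) =
      (if a = 0 then (n : ℝ) * W μ else W (a :: μ)) + cutJoin W ((a + 1) :: μ)) :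
    ∀ d ≤ n, ∀ l, IsCompositionOf d l →
      HasSum (fun g => (genusCoeff d g l : ℝ) * ((n : ℝ)⁻¹) ^ g) (W l) := by
  intro d
  induction d with
  | zero =>
    intro _ l hl
    have : l = [] := by
      match l, hl with
      | [], _ => rfl
      | b :: μ, hl => have h1 := hl.1 b (by simp); have h2 := hl.2; simp at h2; omega
    subst this
    rw [h0]
    convert hasSum_ite_eq (0 : ℕ) (1 : ℝ) using 2 with g
    by_cases hg : g = 0 <;> simp [genusCoeff, hg]
  | succ d ih =>
    intro hd l hl
    have hn : (0 : ℝ) < n := by exact_mod_cast (by omega : 0 < n)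
    refine hasSum_of_cutJoin_fixedPoint (d := d) (x := (n : ℝ)⁻¹) (by positivity) ?_
      (v := genusSource (genusCoeff d)) (c := genusCoeff (d + 1))
      (V := fun l => W l - (n : ℝ)⁻¹ * cutJoin W l) ?_ (fun l _ => by ring)
      (fun l => rfl) (fun g l => rfl) hl
    · rw [← div_eq_mul_inv, div_lt_one hn]; exact_mod_cast hd
    · intro l hl
      match l, hl with
      | [], hl => simp [IsCompositionOf] at hl
      | 0 :: μ, hl => simpa using hl.1 0
      | 1 :: μ, hl =>
        have hs : μ.sum = d := by have := hl.2; simp at this; omega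
        have hWl := hW 0 μ (by omega)
        have : W (1 :: μ) - (n : ℝ)⁻¹ * cutJoin W (1 :: μ) = W μ := by
          simp only [zero_add, if_true] at hWl
          field_simp; linarith
        rw [this]
        simpa [genusSource] using ih (by omega) μ ⟨fun b hb => hl.1 b (by simp [hb]), hs⟩
      | (a + 2) :: μ, hl =>
        have hs : a + 1 + μ.sum = d := by have := hl.2; simp at this; omega
        have hWl := hW (a + 1) μ (by omega)
        have : W ((a + 2) :: μ) - (n : ℝ)⁻¹ * cutJoin W ((a + 2) :: μ) =
            W ((a + 1) :: μ) * (n : ℝ)⁻¹ := by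
          simp only [Nat.add_eq_zero_iff, one_ne_zero, and_false, if_false] at hWl
          field_simp; linarith
        rw [this]
        have h1 := (ih (by omega) ((a + 1) :: μ) ⟨fun b hb => by
          rcases List.mem_cons.1 hb with rfl | hb
          · omega
          · exact hl.1 b (by simp [hb]), by simpa using hs⟩).mul_right (n : ℝ)⁻¹
        have h2 := (hasSum_nat_add_iff (f := fun g =>
          (genusSource (genusCoeff d) g ((a + 2) :: μ) : ℝ) * ((n : ℝ)⁻¹) ^ g) 1).1
          (by simpa only [genusSource, pow_succ, mul_assoc] using h1)
        simpa [genusSource] using h2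

/-- Every step of the recursion changes `g + l.length - d` by `0` or `2`: cutting a cycle adds one
to the number of cycles, joining two removes one, and both raise `g` by one. This gives the lower
bound on `g` and its parity at once. -/
theorem genusCoeff_ne_zero (d : ℕ) : ∀ g l, IsCompositionOf d l → genusCoeff d g l ≠ 0 →
    ∃ h, g + l.length = d + 2 * h := by
  induction d with
  | zero =>
    intro g l hl hne
    have : l = [] := by
      match l, hl with
      | [], _ => rfl
      | b :: μ, hl => have h1 := hl.1 b (by simp); have h2 := hl.2; simp at h2; omega
    subst this
    by_cases hg : g = 0
    · exact ⟨0, by simp [hg]⟩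
    · simp [genusCoeff, hg] at hne
  | succ d ihd =>
    have hsrc : ∀ g l, IsCompositionOf (d + 1) l → genusSource (genusCoeff d) g l ≠ 0 →
        ∃ h, g + l.length = d + 1 + 2 * h := by
      intro g l hl hne
      match g, l, hl with
      | g, [], hl => simp [IsCompositionOf] at hl
      | g, 0 :: μ, hl => simpa using hl.1 0
      | g, 1 :: μ, hl =>
        obtain ⟨h, hh⟩ := ihd g μ ⟨fun b hb => hl.1 b (by simp [hb]), by
          have := hl.2; simp at this; omega⟩ (by simpa [genusSource] using hne)
        exact ⟨h, by simp; omega⟩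
      | 0, (a + 2) :: μ, hl => simp [genusSource] at hne
      | g + 1, (a + 2) :: μ, hl =>
        obtain ⟨h, hh⟩ := ihd g ((a + 1) :: μ) ⟨fun b hb => by
          rcases List.mem_cons.1 hb with rfl | hb
          · omega
          · exact hl.1 b (by simp [hb]), by have := hl.2; simp at this ⊢; omega⟩
          (by simpa [genusSource] using hne)
        exact ⟨h, by simp at hh ⊢; omega⟩
    intro g
    induction g with
    | zero => exact fun l hl hne => hsrc 0 l hl hne
    | succ g ihg =>
      intro l hl hne
      change genusSource (genusCoeff d) (g + 1) l + cutJoin (genusCoeff (d + 1) g) l ≠ 0 at hne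
      by_cases h1 : genusSource (genusCoeff d) (g + 1) l = 0
      swap
      · exact hsrc _ l hl h1
      rw [h1, zero_add] at hne
      match l, hl with
      | [], hl => simp [IsCompositionOf] at hl
      | 0 :: μ, hl => simpa using hl.1 0
      | (a + 1) :: μ, hl =>
        simp only [cutJoin] at hne
        rcases not_and_or.1 (mt Nat.add_eq_zero_iff.2 hne) with h | h
        · obtain ⟨m, hm, hm'⟩ := Finset.exists_ne_zero_of_sum_ne_zero h
          obtain ⟨h, hh⟩ := ihg _ (hl.cut (Finset.mem_range.1 hm)) hm'
          exact ⟨h, by simp at hh ⊢; omega⟩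
        · obtain ⟨j, -, hj'⟩ := Finset.exists_ne_zero_of_sum_ne_zero h
          obtain ⟨h, hh⟩ := ihg _ (hl.join j) (right_ne_zero_of_mul hj')
          have := j.2
          refine ⟨h + 1, ?_⟩
          have h3 := List.length_eraseIdx_add_one j.2
          simp only [List.length_cons] at hh ⊢
          omega

theorem genusCoeff_one_one (g : ℕ) : genusCoeff 1 g [1] = if g = 0 then 1 else 0 := by
  cases g <;> simp [genusCoeff, genusCoeffStep, genusSource, cutJoin]

/-- The operator exchanges the cycle types `[2]` and `[1, 1]`, so positivity passes between
them. -/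
theorem genusCoeff_two_pos (h : ℕ) :
    0 < genusCoeff 2 (2 * h) [1, 1] ∧ 0 < genusCoeff 2 (2 * h + 1) [2] := by
  have key : ∀ h, 0 < genusCoeff 2 (2 * h) [1, 1] → 0 < genusCoeff 2 (2 * h + 1) [2] := by
    intro h hh
    change 0 < genusSource (genusCoeff 1) (2 * h + 1) [2] + cutJoin (genusCoeff 2 (2 * h)) [2]
    simp only [cutJoin, Finset.sum_range_one]
    simp
    omega
  induction h with
  | zero => exact ⟨by decide, key 0 (by decide)⟩
  | succ h ih =>
    have : 0 < genusCoeff 2 (2 * (h + 1)) [1, 1] := by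
      change 0 < genusSource (genusCoeff 1) (2 * h + 2) [1, 1] +
        cutJoin (genusCoeff 2 (2 * h + 1)) [1, 1]
      have := ih.2
      simp [cutJoin]
      omega
    exact ⟨this, key _ this⟩

theorem genusCoeff_single_pos (k h : ℕ) : 0 < genusCoeff (k + 2) (2 * h + (k + 1)) [k + 2] := by
  induction k with
  | zero => exact (genusCoeff_two_pos h).2
  | succ k ih =>
    change 0 < genusCoeff (k + 2) (2 * h + (k + 1)) [k + 2] + cutJoin _ _
    omega

/-! ### Integration by parts on an open set -/

open Filter Topology in
/-- If `G` is `O(u)` and `u` vanishes on the boundary of `U`, then `u / (u + ε) * G`, extended by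
zero, is differentiable everywhere: at the boundary it is quadratically small. -/
theorem hasLineDerivAt_cutoff {E : Type*} [NormedAddCommGroup E] [NormedSpace ℝ E]
    {U : Set E} (hU : IsOpen U) {u u' B : E → ℝ} {v : E} {G G' : E → ℂ}
    (hu : ∀ x, HasLineDerivAt ℝ u (u' x) x v) (hB : Continuous B)
    (hpos : ∀ x ∈ U, 0 < u x) (hfr : ∀ x ∈ frontier U, u x = 0)
    (hG : ∀ x ∈ U, HasLineDerivAt ℝ G (G' x) x v) (hle : ∀ x ∈ U, ‖G x‖ ≤ u x * B x)
    {ε : ℝ} (hε : 0 < ε) (x : E) :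
    HasLineDerivAt ℝ (U.indicator fun x => (u x / (u x + ε)) • G x)
      (U.indicator (fun x => (u x / (u x + ε)) • G' x + (u' x * ε / (u x + ε) ^ 2) • G x) x) x v := by
  have hcont : ContinuousAt (fun t : ℝ => x + t • v) 0 := by fun_prop
  have htend : Tendsto (fun t : ℝ => x + t • v) (𝓝 0) (𝓝 x) := by
    simpa using hcont.tendsto
  by_cases hx : x ∈ U
  · rw [Set.indicator_of_mem hx]
    have hux := hpos x hx
    have h1 := hu x
    have h2 := hG x hx
    unfold HasLineDerivAt at *
    have h3 : HasDerivAt (fun t : ℝ => u (x + t • v) / (u (x + t • v) + ε))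
        (u' x * ε / (u x + ε) ^ 2) 0 := by
      have := h1.fun_div (h1.add_const ε) (by simp; positivity)
      refine this.congr_deriv ?_
      simp only [zero_smul, add_zero]
      ring
    have h4 := h3.fun_smul h2
    rw [zero_smul, add_zero] at h4
    refine h4.congr_of_eventuallyEq ?_
    filter_upwards [htend (hU.mem_nhds hx)] with t ht
    exact Set.indicator_of_mem (s := U) (a := x + t • v) ht _
  · rw [Set.indicator_of_notMem hx]
    by_cases hcl : x ∈ closure U
    · have hux : u x = 0 := hfr x ⟨hcl, by rwa [hU.interior_eq]⟩
      have h1 : (fun t : ℝ => u (x + t • v)) =O[𝓝 0] fun t : ℝ => t := by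
        have := (hu x).isBigO_sub
        simpa [hux] using this
      have h2 : (fun t : ℝ => B (x + t • v)) =O[𝓝 0] fun _ => (1 : ℝ) :=
        ((hB.tendsto x).comp htend).isBigO_one ℝ
      have h3 : (fun t : ℝ => (U.indicator fun x => (u x / (u x + ε)) • G x) (x + t • v)) =O[𝓝 0]
          fun t : ℝ => ε⁻¹ * (u (x + t • v) * u (x + t • v) * B (x + t • v)) := by
        refine Asymptotics.IsBigO.of_bound 1 (Eventually.of_forall fun t => ?_)
        by_cases ht : x + t • v ∈ U
        · rw [Set.indicator_of_mem ht]
          have hp := hpos _ ht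
          rw [norm_smul, Real.norm_of_nonneg (by positivity), one_mul]
          have hb := hle _ ht
          calc u (x + t • v) / (u (x + t • v) + ε) * ‖G (x + t • v)‖
              ≤ u (x + t • v) / ε * (u (x + t • v) * B (x + t • v)) := by
                gcongr
                linarith
            _ = ε⁻¹ * (u (x + t • v) * u (x + t • v) * B (x + t • v)) := by ring
            _ ≤ _ := le_abs_self _
        · rw [Set.indicator_of_notMem ht, norm_zero]; positivity
      have h4 : (fun t : ℝ => (U.indicator fun x => (u x / (u x + ε)) • G x) (x + t • v)) =O[𝓝 0]
          fun t : ℝ => ‖t - 0‖ ^ 2 := by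
        refine (h3.trans (((h1.mul h1).mul h2).const_mul_left _)).trans ?_
        refine Asymptotics.IsBigO.of_bound 1 (Eventually.of_forall fun t => ?_)
        simp [sq]
      have h5 := (h4.hasFDerivAt (by norm_num)).hasDerivAt
      simpa [HasLineDerivAt] using h5
    · refine (hasDerivAt_const (0 : ℝ) (0 : ℂ)).congr_of_eventuallyEq ?_
      filter_upwards [htend (isClosed_closure.isOpen_compl.mem_nhds hcl)] with t ht
      exact Set.indicator_of_notMem (fun h => ht (subset_closure h)) _

open Filter Topology in
/-- Divergence theorem without boundary term: the integral over `U` of the directional derivative of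
`G` is zero when `G` is dominated by a function `u` vanishing on the boundary of `U`. The cutoff
`u / (u + ε)` makes the integrand differentiable on the whole space, and is removed by dominated
convergence as `ε → 0`. -/
theorem setIntegral_lineDeriv_eq_zero {E : Type*} [NormedAddCommGroup E] [NormedSpace ℝ E]
    [MeasurableSpace E] [BorelSpace E] [FiniteDimensional ℝ E] {m : Measure E} [m.IsAddHaarMeasure]
    {U : Set E} (hU : IsOpen U) {u u' B : E → ℝ} {v : E} {G G' : E → ℂ}
    (hu : ∀ x, HasLineDerivAt ℝ u (u' x) x v) (huc : Continuous u) (hu'c : Continuous u')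
    (hB : Continuous B)
    (hpos : ∀ x ∈ U, 0 < u x) (hfr : ∀ x ∈ frontier U, u x = 0)
    (hG : ∀ x ∈ U, HasLineDerivAt ℝ G (G' x) x v) (hle : ∀ x ∈ U, ‖G x‖ ≤ u x * B x)
    (hGi : IntegrableOn G U m) (hG'i : IntegrableOn G' U m)
    (hBi : IntegrableOn (fun x => B x * |u' x|) U m) :
    ∫ x in U, G' x ∂m = 0 := by
  set D : ℝ → E → ℂ := fun ε x =>
    (u x / (u x + ε)) • G' x + (u' x * ε / (u x + ε) ^ 2) • G x with hD
  have hbound : ∀ ε : ℝ, 0 < ε → ∀ x ∈ U, ‖D ε x‖ ≤ ‖G' x‖ + B x * |u' x| := by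
    intro ε hε x hx
    have hp := hpos x hx
    have hb := hle x hx
    have hB0 : 0 ≤ B x := by
      by_contra hneg
      nlinarith [norm_nonneg (G x)]
    refine (norm_add_le _ _).trans (add_le_add ?_ ?_)
    · rw [norm_smul, Real.norm_of_nonneg (by positivity)]
      exact mul_le_of_le_one_left (norm_nonneg _) ((div_le_one (by positivity)).2 (by linarith))
    · rw [norm_smul, Real.norm_eq_abs, abs_div, abs_mul, abs_of_pos hε,
        abs_of_pos (by positivity : 0 < (u x + ε) ^ 2)]
      calc |u' x| * ε / (u x + ε) ^ 2 * ‖G x‖ ≤ |u' x| * ε / (u x + ε) ^ 2 * (u x * B x) := by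
            gcongr
        _ = (ε * u x / (u x + ε) ^ 2) * (B x * |u' x|) := by ring
        _ ≤ 1 * (B x * |u' x|) := by
            gcongr
            rw [div_le_one (by positivity)]
            nlinarith
        _ = _ := one_mul _
  have hmeas : ∀ ε : ℝ, AEStronglyMeasurable (D ε) (m.restrict U) := by
    intro ε
    refine AEStronglyMeasurable.add ?_ ?_
    · exact ((huc.measurable.div (huc.measurable.add_const ε)).aestronglyMeasurable).smul hG'i.1
    · exact (((hu'c.measurable.mul_const ε).div
        ((huc.measurable.add_const ε).pow_const 2)).aestronglyMeasurable).smul hGi.1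
  have hDi : ∀ ε : ℝ, 0 < ε → IntegrableOn (D ε) U m := fun ε hε =>
    (hG'i.norm.add hBi).mono' (hmeas ε)
      ((ae_restrict_iff' hU.measurableSet).2 (Eventually.of_forall fun x hx => hbound ε hε x hx))
  have hzero : ∀ ε : ℝ, 0 < ε → ∫ x in U, D ε x ∂m = 0 := by
    intro ε hε
    have hline := hasLineDerivAt_cutoff hU hu hB hpos hfr hG hle hε
    have hg : Integrable (U.indicator fun x => (u x / (u x + ε)) • G x) m := by
      rw [integrable_indicator_iff hU.measurableSet]
      refine hGi.norm.mono' (((huc.measurable.div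
        (huc.measurable.add_const ε)).aestronglyMeasurable).smul hGi.1)
        ((ae_restrict_iff' hU.measurableSet).2 (Eventually.of_forall fun x hx => ?_))
      have hp := hpos x hx
      rw [norm_smul, Real.norm_of_nonneg (by positivity)]
      exact mul_le_of_le_one_left (norm_nonneg _) ((div_le_one (by positivity)).2 (by linarith))
    have hg' : Integrable (U.indicator (D ε)) m :=
      (integrable_indicator_iff hU.measurableSet).2 (hDi ε hε)
    have := integral_bilinear_hasLineDerivAt_right_eq_neg_left_of_integrable (μ := m)
      (f := fun _ => (1 : ℝ)) (f' := fun _ => 0) (g := _) (g' := U.indicator (D ε)) (v := v)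
      (B := ContinuousLinearMap.lsmul ℝ ℝ) (by simp) (by simpa using hg') (by simpa using hg)
      (fun x _ => hasDerivAt_const _ _) (fun x _ => hline x)
    rw [← integral_indicator hU.measurableSet]
    simpa using this
  have hlim : Tendsto (fun k : ℕ => ∫ x in U, D (1 / ((k : ℝ) + 1)) x ∂m) atTop
      (𝓝 (∫ x in U, G' x ∂m)) := by
    refine tendsto_integral_of_dominated_convergence _ (fun k => hmeas _) (hG'i.norm.add hBi)
      (fun k => (ae_restrict_iff' hU.measurableSet).2
        (Eventually.of_forall fun x hx => hbound _ (by positivity) x hx))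
      ((ae_restrict_iff' hU.measurableSet).2 (Eventually.of_forall fun x hx => ?_))
    have hp := (hpos x hx).ne'
    have h0 : Tendsto (fun k : ℕ => 1 / ((k : ℝ) + 1)) atTop (𝓝 0) :=
      tendsto_one_div_add_atTop_nhds_zero_nat
    have hc : ContinuousAt (fun ε : ℝ => D ε x) 0 := by
      simp only [hD]
      have : u x + 0 ≠ 0 := by simpa using hp
      fun_prop (disch := simp [hp])
    have := hc.tendsto.comp h0
    simpa [hD, hp, Function.comp_def] using this
  refine tendsto_nhds_unique hlim ?_
  simp only [hzero _ (by positivity : (0 : ℝ) < 1 / ((_ : ℕ) + 1))]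
  exact tendsto_const_nhds

theorem exists_bound_of_homogeneous {E : Type*} [NormedAddCommGroup E] [NormedSpace ℝ E]
    [FiniteDimensional ℝ E] {f : E → ℝ} (hf : Continuous f) {N : ℕ}
    (hN : ∀ (r : ℝ) x, 0 ≤ r → f (r • x) = r ^ N * f x) :
    ∃ C, 0 ≤ C ∧ ∀ x, |f x| ≤ C * ‖x‖ ^ N := by
  have hcpt : IsCompact (Metric.closedBall (0 : E) 1) := isCompact_closedBall 0 1
  obtain ⟨C, hC⟩ := hcpt.exists_bound_of_continuousOn hf.continuousOn
  have hC0 : 0 ≤ C := (norm_nonneg _).trans (hC 0 (by simp))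
  refine ⟨C, hC0, fun x => ?_⟩
  by_cases hx : x = 0
  · have h0 := hN 0 0 le_rfl
    subst hx
    rcases N with _ | N
    · simpa using hC 0 (by simp)
    · simp at h0; simp [h0]
  · have hx' : 0 < ‖x‖ := norm_pos_iff.2 hx
    have : f x = ‖x‖ ^ N * f (‖x‖⁻¹ • x) := by
      rw [← hN _ _ hx'.le, smul_smul, mul_inv_cancel₀ hx'.ne', one_smul]
    rw [this, abs_mul, abs_of_nonneg (by positivity), mul_comm]
    gcongr
    exact hC _ (by simp [norm_smul, hx'.ne'])

theorem integrable_norm_pow_mul_exp_neg_norm {E : Type*} [NormedAddCommGroup E] [NormedSpace ℝ E]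
    [MeasurableSpace E] [BorelSpace E] [FiniteDimensional ℝ E] (m : Measure E) [m.IsAddHaarMeasure]
    (N : ℕ) : Integrable (fun x : E => ‖x‖ ^ N * Real.exp (-‖x‖)) m := by
  set r : ℕ := Module.finrank ℝ E + 1
  have h1 := integrable_one_add_norm (μ := m) (E := E) (r := r) (by simp [r])
  refine (h1.const_mul (((N + r).factorial : ℝ) * Real.exp 1)).mono' (by fun_prop)
    (Filter.Eventually.of_forall fun x => ?_)
  have hx := norm_nonneg x
  rw [Real.norm_of_nonneg (by positivity), Real.rpow_neg (by positivity), Real.rpow_natCast]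
  have h2 := Real.pow_div_factorial_le_exp (1 + ‖x‖) (by positivity) (N + r)
  rw [div_le_iff₀ (by positivity), Real.exp_add, pow_add] at h2
  have h3 : ‖x‖ ^ N ≤ (1 + ‖x‖) ^ N := by gcongr; linarith
  rw [← div_eq_mul_inv, le_div_iff₀ (by positivity), Real.exp_neg, mul_assoc, inv_mul_eq_div,
    ← mul_div_assoc, div_le_iff₀ (by positivity)]
  calc ‖x‖ ^ N * (1 + ‖x‖) ^ r ≤ (1 + ‖x‖) ^ N * (1 + ‖x‖) ^ r := by gcongr
    _ ≤ _ := h2.trans (le_of_eq (by ring))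

/-! ### Derivatives along lines of matrices -/

section MatrixCalculus
open scoped Matrix.Norms.Operator

variable {n : ℕ}

/-- The product of power traces `∏ b ∈ l, Tr Y ^ b`. -/
noncomputable def powerTraceProd (l : List ℕ) (Y : Matrix (Fin n) (Fin n) ℂ) : ℂ :=
  (l.map fun b => (Y ^ b).trace).prod

theorem hasDerivAt_ringInverse_pow_line {R : Type*} [NormedRing R] [NormedAlgebra ℝ R]
    [CompleteSpace R] (u : Rˣ) (D : R) (b : ℕ) :
    HasDerivAt (fun t : ℝ => Ring.inverse ((u : R) + t • D) ^ b)
      (-∑ m ∈ Finset.range b,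
        Ring.inverse (u : R) ^ (m + 1) * D * Ring.inverse (u : R) ^ (b - m)) 0 := by
  have h1 : HasDerivAt (fun t : ℝ => (u : R) + t • D) D 0 := by
    simpa using ((hasDerivAt_id (0 : ℝ)).smul_const D).const_add (u : R)
  have h2 := HasFDerivAt.comp_hasDerivAt_of_eq (0 : ℝ) (hasFDerivAt_ringInverse (𝕜 := ℝ) u) h1
    (by simp)
  have h3 : HasDerivAt (fun t : ℝ => Ring.inverse ((u : R) + t • D))
      (-(Ring.inverse (u : R) * D * Ring.inverse (u : R))) 0 := by
    refine h2.congr_deriv ?_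
    simp
  induction b with
  | zero => simpa using hasDerivAt_const (0 : ℝ) (1 : R)
  | succ b ih =>
    simp only [pow_succ _ b]
    refine (ih.fun_mul h3).congr_deriv ?_
    simp only [zero_smul, add_zero]
    rw [Finset.sum_range_succ, neg_mul, Finset.sum_mul, mul_neg, ← neg_add]
    congr 2
    · refine Finset.sum_congr rfl fun m hm => ?_
      rw [Nat.sub_add_comm (Finset.mem_range.1 hm).le, pow_succ _ (b - m)]
      simp only [mul_assoc]
    · simp [pow_succ, mul_assoc]

theorem hasDerivAt_linear_ringInverse_pow_line {R : Type*} [NormedRing R] [NormedAlgebra ℝ R]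
    [FiniteDimensional ℝ R] (u : Rˣ) (D : R) (b : ℕ) (φ : R →ₗ[ℝ] ℂ) :
    HasDerivAt (fun t : ℝ => φ (Ring.inverse ((u : R) + t • D) ^ b))
      (-∑ m ∈ Finset.range b,
        φ (Ring.inverse (u : R) ^ (m + 1) * D * Ring.inverse (u : R) ^ (b - m))) 0 := by
  have : CompleteSpace R := FiniteDimensional.complete ℝ R
  have h := (LinearMap.toContinuousLinearMap φ).hasFDerivAt.comp_hasDerivAt (0 : ℝ)
    (hasDerivAt_ringInverse_pow_line u D b)
  refine h.congr_deriv ?_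
  simp

theorem hasDerivAt_trace_mul_inv_pow_line {A : Matrix (Fin n) (Fin n) ℂ} (hA : IsUnit A)
    (D E : Matrix (Fin n) (Fin n) ℂ) (b : ℕ) :
    HasDerivAt (fun t : ℝ => (E * (A + t • D)⁻¹ ^ b).trace)
      (-∑ m ∈ Finset.range b, (E * (A⁻¹ ^ (m + 1) * D * A⁻¹ ^ (b - m))).trace) 0 := by
  obtain ⟨u, rfl⟩ := hA
  simp only [Matrix.nonsing_inv_eq_ringInverse]
  exact hasDerivAt_linear_ringInverse_pow_line u D b
    ((Matrix.traceLinearMap (Fin n) ℝ ℂ).comp (LinearMap.mulLeft ℝ E))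

theorem hasDerivAt_trace_inv_pow_line {A : Matrix (Fin n) (Fin n) ℂ} (hA : IsUnit A)
    (D : Matrix (Fin n) (Fin n) ℂ) (b : ℕ) :
    HasDerivAt (fun t : ℝ => ((A + t • D)⁻¹ ^ b).trace)
      (-(b * (D * A⁻¹ ^ (b + 1)).trace)) 0 := by
  have h := hasDerivAt_trace_mul_inv_pow_line hA D 1 b
  simp only [one_mul] at h
  refine h.congr_deriv ?_
  rw [Finset.sum_congr rfl (g := fun _ => (D * A⁻¹ ^ (b + 1)).trace)]
  · simp
  · intro m hm
    rw [mul_assoc, Matrix.trace_mul_comm, mul_assoc, ← pow_add]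
    congr 3
    have := Finset.mem_range.1 hm
    omega

theorem hasDerivAt_powerTraceProd_line {A : Matrix (Fin n) (Fin n) ℂ} (hA : IsUnit A)
    (D : Matrix (Fin n) (Fin n) ℂ) (l : List ℕ) :
    HasDerivAt (fun t : ℝ => powerTraceProd l (A + t • D)⁻¹)
      (-∑ j : Fin l.length, (l[j] : ℂ) * (D * A⁻¹ ^ (l[j] + 1)).trace *
        powerTraceProd (l.eraseIdx j) A⁻¹) 0 := by
  induction l with
  | nil => simpa [powerTraceProd] using hasDerivAt_const (0 : ℝ) (1 : ℂ)
  | cons b l ih =>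
    have h := (hasDerivAt_trace_inv_pow_line hA D b).fun_mul ih
    refine (h.congr_deriv ?_)
    simp only [zero_smul, add_zero, List.length_cons]
    rw [Fin.sum_univ_succ, neg_mul, mul_neg, ← neg_add, Finset.mul_sum]
    simp only [powerTraceProd, Fin.getElem_fin, Fin.val_zero, List.getElem_cons_zero,
      List.eraseIdx_cons_zero, Fin.val_succ, List.getElem_cons_succ, List.eraseIdx_cons_succ,
      List.map_cons, List.prod_cons]
    congr 2
    exact Finset.sum_congr rfl fun j _ => by ring

/-- Jacobi's formula. -/
theorem hasDerivAt_det_line {A : Matrix (Fin n) (Fin n) ℂ} (hA : IsUnit A)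
    (D : Matrix (Fin n) (Fin n) ℂ) :
    HasDerivAt (fun t : ℝ => (A + t • D).det) (A.det * (D * A⁻¹).trace) 0 := by
  have hdet : IsUnit A.det := (Matrix.isUnit_iff_isUnit_det A).1 hA
  set p : Polynomial ℂ := (1 + (Polynomial.X : Polynomial ℂ) • (A⁻¹ * D).map Polynomial.C).det
  have hp : ∀ z : ℂ, p.eval z = (1 + z • (A⁻¹ * D)).det := by
    intro z
    change Polynomial.evalRingHom z _ = _
    rw [RingHom.map_det]
    congr 1
    ext i j
    by_cases hij : i = j <;> simp [hij, -Matrix.map_mul, mul_comm z]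
  have h1 : HasDerivAt (fun z : ℂ => p.eval z) (A⁻¹ * D).trace ((0 : ℝ) : ℂ) := by
    have := p.hasDerivAt ((0 : ℝ) : ℂ)
    rwa [Complex.ofReal_zero, Matrix.derivative_det_one_add_X_smul] at this
  have h2 := h1.comp_ofReal.const_mul A.det
  rw [Matrix.trace_mul_comm D]
  refine h2.congr_of_eventuallyEq (Filter.Eventually.of_forall fun t => ?_)
  simp only [hp]
  rw [← Matrix.det_mul, mul_add, mul_one, mul_smul_comm, ← mul_assoc,
    Matrix.mul_nonsing_inv A hdet, one_mul]
  rfl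

/-- The Laguerre density `(det A) ^ n * exp (-Tr A)` with parameter equal to the size, as a complex
number, so that it can be differentiated without splitting off real parts. -/
noncomputable def laguerreWeight (A : Matrix (Fin n) (Fin n) ℂ) : ℂ :=
  A.det ^ n * Complex.exp (-A.trace)

theorem hasDerivAt_laguerreWeight_line {A : Matrix (Fin n) (Fin n) ℂ} (hA : IsUnit A)
    (D : Matrix (Fin n) (Fin n) ℂ) :
    HasDerivAt (fun t : ℝ => laguerreWeight (A + t • D))
      ((n * (D * A⁻¹).trace - D.trace) * laguerreWeight A) 0 := by
  have h1 : HasDerivAt (fun t : ℝ => (A + t • D).trace) D.trace 0 := by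
    simpa [Matrix.trace_add, Matrix.trace_smul] using
      (((hasDerivAt_id (0 : ℝ)).smul_const D.trace).const_add A.trace)
  have h2 := h1.fun_neg.cexp
  have h3 := (hasDerivAt_det_line hA D).fun_pow n
  refine (h3.fun_mul h2).congr_deriv ?_
  simp only [zero_smul, add_zero, laguerreWeight]
  rcases n with _ | n
  · simp
  · simp only [Nat.add_sub_cancel]
    push_cast
    ring

/-! ### A basis of the Hermitian matrices -/

/-- The basis of the Hermitian matrices given by the coordinates of `hermitianOfCoords`: matrix units
on the diagonal, `E p q + E q p` for `p < q`, and `I • (E q p - E p q)` for `q < p`. -/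
noncomputable def hermitianBasis (p q : Fin n) : Matrix (Fin n) (Fin n) ℂ :=
  hermitianOfCoords n (Pi.single p (Pi.single q 1))

theorem hermitianBasis_apply (p q c d : Fin n) : hermitianBasis p q c d =
    if c < d then (if p = c ∧ q = d then 1 else 0) + (if p = d ∧ q = c then Complex.I else 0)
    else if d < c then
      (if p = d ∧ q = c then 1 else 0) - (if p = c ∧ q = d then Complex.I else 0)
    else if p = c ∧ q = d then 1 else 0 := by
  simp only [hermitianBasis, hermitianOfCoords, Matrix.of_apply, Pi.single_apply]
  rcases lt_trichotomy c d with h | h | h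
  · simp only [h, if_true, Complex.ext_iff]
    constructor <;> by_cases h1 : p = c <;> by_cases h2 : q = d <;> by_cases h3 : p = d <;>
      by_cases h4 : q = c <;> simp_all [eq_comm]
  · simp only [h, lt_irrefl, if_false, Complex.ext_iff]
    constructor <;> by_cases h1 : p = d <;> by_cases h2 : q = d <;> simp_all [eq_comm]
  · simp only [h, h.not_gt, if_true, if_false, Complex.ext_iff]
    constructor <;> by_cases h1 : p = c <;> by_cases h2 : q = d <;> by_cases h3 : p = d <;>
      by_cases h4 : q = c <;> simp_all [eq_comm]

theorem star_hermitianBasis_apply (p q c d : Fin n) :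
    star (hermitianBasis p q c d) = hermitianBasis p q d c :=
  (hermitianOfCoords_isHermitian n _).apply d c

/-- Completeness of the real basis `D p q`, with weight `1` on the diagonal and `1 / 2` off it:
`∑ c p q • D p q ⊗ D p q = ∑ a b, E a b ⊗ E b a`, where the `E a b` are the matrix units. -/
theorem sum_hermitianBasis_mul (a b a' b' : Fin n) :
    ∑ p, ∑ q, (if p = q then (1 : ℂ) else 1 / 2) *
      (hermitianBasis p q a b * hermitianBasis p q a' b') =
      if a = b' ∧ b = a' then 1 else 0 := by
  have hsum : ∀ (f : Fin n → Fin n → ℂ) (c d : Fin n),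
      ∑ p, ∑ q, (if p = c ∧ q = d then f p q else 0) = f c d := by
    intro f c d
    simp [ite_and]
  have hlt : ∀ a b a' b' : Fin n, a < b → ∑ p, ∑ q, (if p = q then (1 : ℂ) else 1 / 2) *
      (hermitianBasis p q a b * hermitianBasis p q a' b') =
      if a = b' ∧ b = a' then 1 else 0 := by
    intro a b a' b' h
    have h1 : ∑ p, ∑ q, (if p = q then (1 : ℂ) else 1 / 2) *
        (hermitianBasis p q a b * hermitianBasis p q a' b') =
        1 / 2 * hermitianBasis a b a' b' + 1 / 2 * Complex.I * hermitianBasis b a a' b' := by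
      have e : ∀ p q, (if p = q then (1 : ℂ) else 1 / 2) *
          (hermitianBasis p q a b * hermitianBasis p q a' b') =
          (if p = a ∧ q = b then 1 / 2 * hermitianBasis p q a' b' else 0) +
          (if p = b ∧ q = a then 1 / 2 * Complex.I * hermitianBasis p q a' b' else 0) := by
        intro p q
        rw [hermitianBasis_apply p q a b, if_pos h]
        by_cases h1 : p = a ∧ q = b
        · obtain ⟨rfl, rfl⟩ := h1
          simp [h.ne, h.ne']
        · by_cases h2 : p = b ∧ q = a
          · obtain ⟨rfl, rfl⟩ := h2
            simp [h.ne, h.ne', mul_assoc]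
          · simp [h1, h2]
      simp only [e, Finset.sum_add_distrib, hsum]
    rw [h1, hermitianBasis_apply, hermitianBasis_apply]
    rcases lt_trichotomy a' b' with h' | h' | h'
    · simp only [h', if_true]
      by_cases e1 : a = a' <;> by_cases e2 : b = b' <;> by_cases e3 : a = b' <;>
        by_cases e4 : b = a' <;>
        first
        | (exfalso; omega)
        | simp [e1, e2, e3, e4, h'.ne, h'.ne', mul_assoc]
    · simp only [h', lt_irrefl, if_false]
      by_cases e3 : a = b' <;> by_cases e4 : b = b' <;>
        first
        | (exfalso; omega)
        | simp [e3, e4]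
    · simp only [h', h'.not_gt, if_true, if_false]
      by_cases e1 : a = a' <;> by_cases e2 : b = b' <;> by_cases e3 : a = b' <;>
        by_cases e4 : b = a' <;>
        first
        | (exfalso; omega)
        | (simp [e1, e2, e3, e4, h'.ne, h'.ne', mul_assoc] <;> norm_num)
  rcases lt_trichotomy a b with h | rfl | h
  · exact hlt a b a' b' h
  · have e : ∀ p q, (if p = q then (1 : ℂ) else 1 / 2) *
        (hermitianBasis p q a a * hermitianBasis p q a' b') =
        (if p = a ∧ q = a then hermitianBasis p q a' b' else 0) := by
      intro p q
      rw [hermitianBasis_apply p q a a]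
      by_cases h1 : p = a ∧ q = a
      · obtain ⟨rfl, rfl⟩ := h1
        simp
      · simp [h1]
    simp only [e, hsum]
    rw [hermitianBasis_apply]
    by_cases e1 : a = a' <;> by_cases e2 : a = b' <;>
      rcases lt_trichotomy a' b' with h' | h' | h' <;>
      first
      | (exfalso; omega)
      | simp [e1, e2, h', h'.ne, h'.ne', h'.not_gt]
      | simp [e1, e2, h']
  · -- Conjugation exchanges row and column indices of the basis matrices.
    have hconj := congrArg star (hlt b a b' a' h)
    rw [star_sum] at hconj
    simp only [star_sum, star_mul', star_hermitianBasis_apply] at hconj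
    have hreal : ∀ p q : Fin n, star (if p = q then (1 : ℂ) else 1 / 2) =
        if p = q then (1 : ℂ) else 1 / 2 := by
      intro p q
      split_ifs <;> simp
    simp only [hreal] at hconj
    rw [hconj]
    by_cases e1 : a = b' <;> by_cases e2 : b = a' <;> simp [e1, e2]

theorem sum_hermitianBasis_bilinear (φ : Fin n → Fin n → Fin n → Fin n → ℂ) :
    ∑ p, ∑ q, (if p = q then (1 : ℂ) else 1 / 2) *
      ∑ a, ∑ b, ∑ a', ∑ b', hermitianBasis p q a b * hermitianBasis p q a' b' * φ a b a' b' =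
      ∑ a, ∑ b, φ a b b a := by
  have h1 : ∑ p, ∑ q, (if p = q then (1 : ℂ) else 1 / 2) *
      ∑ a, ∑ b, ∑ a', ∑ b', hermitianBasis p q a b * hermitianBasis p q a' b' * φ a b a' b' =
      ∑ s : Fin n × Fin n, ∑ r : Fin n × Fin n × Fin n × Fin n,
        (if s.1 = s.2 then (1 : ℂ) else 1 / 2) * (hermitianBasis s.1 s.2 r.1 r.2.1 *
          hermitianBasis s.1 s.2 r.2.2.1 r.2.2.2) * φ r.1 r.2.1 r.2.2.1 r.2.2.2 := by
    simp only [Fintype.sum_prod_type, Finset.mul_sum, mul_assoc]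
  rw [h1, Finset.sum_comm]
  simp only [← Finset.sum_mul]
  have h2 : ∀ r : Fin n × Fin n × Fin n × Fin n, (∑ s : Fin n × Fin n,
      (if s.1 = s.2 then (1 : ℂ) else 1 / 2) * (hermitianBasis s.1 s.2 r.1 r.2.1 *
          hermitianBasis s.1 s.2 r.2.2.1 r.2.2.2)) =
      if r.1 = r.2.2.2 ∧ r.2.1 = r.2.2.1 then 1 else 0 := by
    intro r
    rw [← sum_hermitianBasis_mul, Fintype.sum_prod_type]
  simp only [h2]
  simp only [Fintype.sum_prod_type, ite_and, ite_mul, one_mul, zero_mul]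
  refine Finset.sum_congr rfl fun a _ => Finset.sum_congr rfl fun b _ => ?_
  simp

theorem sum_trace_mul_trace (A B : Matrix (Fin n) (Fin n) ℂ) :
    ∑ p, ∑ q, (if p = q then (1 : ℂ) else 1 / 2) *
      ((hermitianBasis p q * A).trace * (hermitianBasis p q * B).trace) = (A * B).trace := by
  have h := sum_hermitianBasis_bilinear fun a b a' b' => A b a * B b' a'
  have h2 : ∑ a, ∑ b, A b a * B a b = (A * B).trace := by
    rw [Finset.sum_comm]; simp [Matrix.trace, Matrix.mul_apply]
  rw [← h2, ← h]
  refine Finset.sum_congr rfl fun p _ => Finset.sum_congr rfl fun q _ => ?_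
  congr 1
  simp only [Matrix.trace, Matrix.diag, Matrix.mul_apply, Finset.sum_mul]
  simp only [Finset.mul_sum]
  refine Finset.sum_congr rfl fun a _ => Finset.sum_congr rfl fun b _ =>
    Finset.sum_congr rfl fun a' _ => Finset.sum_congr rfl fun b' _ => by ring

theorem sum_trace_mul_mul_mul (A B : Matrix (Fin n) (Fin n) ℂ) :
    ∑ p, ∑ q, (if p = q then (1 : ℂ) else 1 / 2) *
      (hermitianBasis p q * (A * hermitianBasis p q * B)).trace = A.trace * B.trace := by
  have h := sum_hermitianBasis_bilinear fun a b a' b' => A b a' * B b' a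
  have h2 : ∑ a, ∑ b, A b b * B a a = A.trace * B.trace := by
    rw [Finset.sum_comm]; simp [Matrix.trace, Finset.sum_mul_sum]
  rw [← h2, ← h]
  refine Finset.sum_congr rfl fun p _ => Finset.sum_congr rfl fun q _ => ?_
  congr 1
  simp only [Matrix.trace, Matrix.diag, Matrix.mul_apply, Finset.sum_mul, Finset.mul_sum]
  refine Finset.sum_congr rfl fun a _ => Finset.sum_congr rfl fun b _ => ?_
  rw [Finset.sum_comm]
  refine Finset.sum_congr rfl fun a' _ => Finset.sum_congr rfl fun b' _ => by ring

end MatrixCalculus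

/-! ### The cone of positive definite matrices -/

section Cone
variable {n : ℕ}

theorem hermitianOfCoords_add (x y : Fin n → Fin n → ℝ) :
    hermitianOfCoords n (x + y) = hermitianOfCoords n x + hermitianOfCoords n y := by
  ext i j
  simp only [hermitianOfCoords, Matrix.of_apply, Matrix.add_apply, Pi.add_apply]
  split_ifs <;> simp [Complex.ext_iff]
  ring

theorem hermitianOfCoords_smul (r : ℝ) (x : Fin n → Fin n → ℝ) :
    hermitianOfCoords n (r • x) = r • hermitianOfCoords n x := by
  ext i j
  simp only [hermitianOfCoords, Matrix.of_apply, Matrix.smul_apply, Pi.smul_apply]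
  split_ifs <;> simp [Complex.ext_iff]

/-- The coordinate map as a real linear map. -/
noncomputable def hermitianOfCoordsLinear (n : ℕ) :
    (Fin n → Fin n → ℝ) →ₗ[ℝ] Matrix (Fin n) (Fin n) ℂ where
  toFun := hermitianOfCoords n
  map_add' := hermitianOfCoords_add
  map_smul' := hermitianOfCoords_smul

theorem continuous_hermitianOfCoords : Continuous (hermitianOfCoords n) :=
  (hermitianOfCoordsLinear n).continuous_of_finiteDimensional

theorem contDiff_hermitianOfCoords_apply (i j : Fin n) :
    ContDiff ℝ 1 fun x => hermitianOfCoords n x i j := by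
  have : ContDiff ℝ 1 fun x : Fin n → Fin n → ℝ =>
      LinearMap.toContinuousLinearMap ((Matrix.entryLinearMap ℝ ℂ i j).comp
        (hermitianOfCoordsLinear n)) x := ContinuousLinearMap.contDiff _
  exact this

theorem contDiff_det_hermitianOfCoords :
    ContDiff ℝ 1 fun x => (hermitianOfCoords n x).det.re := by
  refine Complex.reCLM.contDiff.comp ?_
  simp only [Matrix.det_apply]
  refine ContDiff.sum fun σ _ => ContDiff.const_smul _ (contDiff_prod fun i _ => ?_)
  exact contDiff_hermitianOfCoords_apply _ _

/-- The positive definite matrices, in coordinates. -/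
def posDefCone (n : ℕ) : Set (Fin n → Fin n → ℝ) := {x | (hermitianOfCoords n x).PosDef}

open Topology Filter in
/-- By homogeneity, positivity of the quadratic form need only be checked on the unit sphere, which
is compact. -/
theorem isOpen_posDefCone : IsOpen (posDefCone n) := by
  have hq : Continuous fun z : (Fin n → Fin n → ℝ) × (Fin n → ℂ) =>
      (star z.2 ⬝ᵥ (hermitianOfCoords n z.1).mulVec z.2).re := by
    have := continuous_hermitianOfCoords (n := n)
    fun_prop
  rw [isOpen_iff_eventually]
  intro x hx
  have hcpt : IsCompact (Metric.sphere (0 : Fin n → ℂ) 1) := isCompact_sphere _ _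
  have h := hcpt.eventually_forall_of_forall_eventually (x₀ := x)
    (P := fun x v => 0 < (star v ⬝ᵥ (hermitianOfCoords n x).mulVec v).re) (fun v hv => by
      have hv0 : v ≠ 0 := by rintro rfl; simp at hv
      have := (Complex.pos_iff.1 (hx.dotProduct_mulVec_pos hv0)).1
      exact hq.continuousAt.eventually (lt_mem_nhds this))
  filter_upwards [h] with y hy
  refine Matrix.PosDef.of_dotProduct_mulVec_pos (hermitianOfCoords_isHermitian n y) fun v hv => ?_
  have hv' : ‖v‖ ≠ 0 := norm_ne_zero_iff.2 hv
  have h1 := hy ((‖v‖⁻¹ : ℂ) • v) (by simp [norm_smul, hv'])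
  have h2 : (star ((‖v‖⁻¹ : ℂ) • v) ⬝ᵥ (hermitianOfCoords n y).mulVec ((‖v‖⁻¹ : ℂ) • v)) =
      ((‖v‖⁻¹ ^ 2 : ℝ) : ℂ) * (star v ⬝ᵥ (hermitianOfCoords n y).mulVec v) := by
    simp [Matrix.mulVec_smul, sq, mul_assoc]
  rw [h2, Complex.re_ofReal_mul] at h1
  have h3 := pos_of_mul_pos_right h1 (by positivity)
  refine Complex.pos_iff.2 ⟨h3, ?_⟩
  exact ((hermitianOfCoords_isHermitian n y).im_star_dotProduct_mulVec_self v).symm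

theorem isClosed_posSemidef : IsClosed {A : Matrix (Fin n) (Fin n) ℂ | A.PosSemidef} := by
  simp only [Matrix.posSemidef_iff_dotProduct_mulVec, Set.ofPred_and, Set.ofPred_forall]
  refine IsClosed.inter ?_ (isClosed_iInter fun v => ?_)
  · exact isClosed_eq (by fun_prop) continuous_id
  · exact isClosed_Ici.preimage (by fun_prop : Continuous fun A : Matrix (Fin n) (Fin n) ℂ =>
      star v ⬝ᵥ A.mulVec v)

theorem det_eq_zero_of_posSemidef_of_not_posDef {A : Matrix (Fin n) (Fin n) ℂ}
    (h : A.PosSemidef) (h' : ¬ A.PosDef) : A.det = 0 := by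
  by_contra hdet
  exact h' (h.posDef_iff_isUnit.2 ((Matrix.isUnit_iff_isUnit_det A).2 (isUnit_iff_ne_zero.2 hdet)))

theorem det_re_eq_zero_of_mem_frontier {x : Fin n → Fin n → ℝ} (hx : x ∈ frontier (posDefCone n)) :
    (hermitianOfCoords n x).det.re = 0 := by
  have h1 : x ∈ {x | (hermitianOfCoords n x).PosSemidef} :=
    closure_minimal (fun y (hy : (hermitianOfCoords n y).PosDef) => hy.posSemidef)
      (isClosed_posSemidef.preimage continuous_hermitianOfCoords) hx.1
  have h2 : ¬ (hermitianOfCoords n x).PosDef := fun h => hx.2 (by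
    rw [isOpen_posDefCone.interior_eq]; exact h)
  rw [det_eq_zero_of_posSemidef_of_not_posDef h1 h2]
  rfl

theorem trace_hermitianOfCoords (x : Fin n → Fin n → ℝ) :
    (hermitianOfCoords n x).trace = ((∑ i, x i i : ℝ) : ℂ) := by
  simp [Matrix.trace, hermitianOfCoords, Complex.ext_iff]

/-- On the cone the trace controls all coordinates; for off-diagonal ones this is positivity of the
quadratic form at `e i + c • e j` with `c = ±1, ±I`. -/
theorem norm_le_trace {x : Fin n → Fin n → ℝ} (hx : (hermitianOfCoords n x).PosSemidef) :
    ‖x‖ ≤ ∑ i, x i i := by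
  have hdiag : ∀ i, 0 ≤ x i i := fun i => by
    have := (Complex.nonneg_iff.1 (hx.diag_nonneg (i := i))).1
    simpa [hermitianOfCoords] using this
  have hle : ∀ i, x i i ≤ ∑ i, x i i := fun i =>
    Finset.single_le_sum (f := fun i => x i i) (fun i _ => hdiag i) (Finset.mem_univ i)
  have hsum : 0 ≤ ∑ i, x i i := Finset.sum_nonneg fun i _ => hdiag i
  have hquad : ∀ i j, i < j → ∀ c : ℂ,
      0 ≤ x i i + x j j * Complex.normSq c + 2 * (c * ⟨x i j, x j i⟩ : ℂ).re := by
    intro i j hij c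
    have h := (Complex.nonneg_iff.1 (hx.dotProduct_mulVec_nonneg
      (Pi.single i 1 + Pi.single j c))).1
    have e : star (Pi.single i 1 + Pi.single j c : Fin n → ℂ) =
        Pi.single i 1 + Pi.single j (star c) := by
      rw [star_add, Pi.star_single, Pi.star_single, star_one]
    rw [e] at h
    simp [Matrix.mulVec_add, add_dotProduct, dotProduct_add, hermitianOfCoords, hij, hij.not_gt,
      Matrix.mulVec_single, single_dotProduct] at h
    simp [Complex.normSq_apply]
    nlinarith
  have hoff : ∀ i j, i < j → |x i j| ≤ ∑ i, x i i ∧ |x j i| ≤ ∑ i, x i i := by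
    intro i j hij
    have h1 := hquad i j hij 1
    have h2 := hquad i j hij (-1)
    have h3 := hquad i j hij Complex.I
    have h4 := hquad i j hij (-Complex.I)
    simp at h1 h2 h3 h4
    have := hle i
    have := hle j
    constructor <;> rw [abs_le] <;> constructor <;> linarith
  refine (pi_norm_le_iff_of_nonneg hsum).2 fun i => (pi_norm_le_iff_of_nonneg hsum).2 fun j => ?_
  rw [Real.norm_eq_abs]
  rcases lt_trichotomy i j with h | rfl | h
  · exact (hoff i j h).1
  · rw [abs_of_nonneg (hdiag i)]; exact hle i
  · exact (hoff j i h).2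

theorem det_eq_ofReal_of_posDef {A : Matrix (Fin n) (Fin n) ℂ} (hA : A.PosDef) :
    0 < A.det.re ∧ A.det = (A.det.re : ℂ) := by
  have h := Complex.pos_iff.1 hA.det_pos
  exact ⟨h.1, Complex.ext rfl (by simp [h.2.symm])⟩

open scoped Matrix.Norms.Operator in
theorem norm_adjugate_of_posDef {A : Matrix (Fin n) (Fin n) ℂ} (hA : A.PosDef) :
    ‖A.adjugate‖ = A.det.re * ‖A⁻¹‖ := by
  obtain ⟨h1, h2⟩ := det_eq_ofReal_of_posDef hA
  have h3 : A.adjugate = A.det • A⁻¹ := by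
    rw [Matrix.inv_def, smul_smul, Ring.mul_inverse_cancel _ (isUnit_iff_ne_zero.2 hA.det_pos.ne'),
      one_smul]
  rw [h3, norm_smul]
  congr 1
  rw [h2, Complex.norm_real, Real.norm_of_nonneg h1.le, Complex.ofReal_re]

open scoped Matrix.Norms.Operator in
/-- The functions `|det| ^ j * ‖adjugate‖ ^ k * exp (-Tr)` that dominate all integrands below. Since
`det X • X⁻¹ = adjugate X`, trading `k` powers of the determinant for powers of the adjugate bounds
any expression of degree `k` in the inverse. -/
noncomputable def dominatingKernel (n j k : ℕ) (x : Fin n → Fin n → ℝ) : ℝ :=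
  |(hermitianOfCoords n x).det.re| ^ j * ‖(hermitianOfCoords n x).adjugate‖ ^ k *
    Real.exp (-∑ i, x i i)

open scoped Matrix.Norms.Operator in
theorem continuous_norm_adjugate :
    Continuous fun x : Fin n → Fin n → ℝ => ‖(hermitianOfCoords n x).adjugate‖ :=
  continuous_norm.comp (continuous_hermitianOfCoords.matrix_adjugate)

theorem continuous_det_re : Continuous fun x => (hermitianOfCoords n x).det.re :=
  contDiff_det_hermitianOfCoords.continuous

theorem continuous_dominatingKernel (j k : ℕ) : Continuous (dominatingKernel n j k) := by
  have h1 := continuous_norm_adjugate (n := n)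
  have h2 := continuous_det_re (n := n)
  unfold dominatingKernel
  fun_prop

open scoped Matrix.Norms.Operator in
theorem dominatingKernel_nonneg (j k : ℕ) (x : Fin n → Fin n → ℝ) :
    0 ≤ dominatingKernel n j k x := by
  unfold dominatingKernel
  positivity

open scoped Matrix.Norms.Operator in
/-- The polynomial factor is homogeneous and `‖x‖ ≤ Tr`, so the kernel is at most
`C * ‖x‖ ^ N * exp (-‖x‖)`. -/
theorem integrableOn_dominatingKernel (j k : ℕ) :
    IntegrableOn (dominatingKernel n j k) (posDefCone n) := by
  have h1 := continuous_norm_adjugate (n := n)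
  have h2 := continuous_det_re (n := n)
  obtain ⟨C, hC0, hC⟩ := exists_bound_of_homogeneous (N := n * j + (n - 1) * k)
    (f := fun x : Fin n → Fin n → ℝ => |(hermitianOfCoords n x).det.re| ^ j *
      ‖(hermitianOfCoords n x).adjugate‖ ^ k) (by fun_prop) (by
      intro r x hr
      have e1 : (r • hermitianOfCoords n x) = (r : ℂ) • hermitianOfCoords n x := by
        ext; simp
      simp only [hermitianOfCoords_smul]
      rw [e1, Matrix.det_smul, Matrix.adjugate_smul, norm_smul, ← Complex.ofReal_pow,
        ← Complex.ofReal_pow, Complex.re_ofReal_mul, Complex.norm_real, Fintype.card_fin, abs_mul,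
        Real.norm_of_nonneg (by positivity), abs_of_nonneg (by positivity : 0 ≤ r ^ n)]
      ring)
  refine ((integrable_norm_pow_mul_exp_neg_norm volume
    (n * j + (n - 1) * k)).const_mul C).integrableOn.mono'
    (continuous_dominatingKernel j k).aestronglyMeasurable
    ((ae_restrict_iff' isOpen_posDefCone.measurableSet).2 (Filter.Eventually.of_forall fun x hx => ?_))
  rw [Real.norm_of_nonneg (dominatingKernel_nonneg j k x), dominatingKernel, ← mul_assoc]
  have h3 := norm_le_trace (Matrix.PosDef.posSemidef hx)
  refine mul_le_mul ((le_abs_self _).trans (hC x)) ?_ (by positivity) (by positivity)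
  exact Real.exp_le_exp.2 (by linarith)

end Cone

/-! ### Loop equations -/

theorem exists_norm_linearMap_le {E : Type*} [NormedAddCommGroup E] [NormedSpace ℝ E]
    [FiniteDimensional ℝ E] (φ : E →ₗ[ℝ] ℂ) : ∃ C, 0 ≤ C ∧ ∀ x, ‖φ x‖ ≤ C * ‖x‖ :=
  ⟨‖LinearMap.toContinuousLinearMap φ‖, norm_nonneg _,
    (LinearMap.toContinuousLinearMap φ).le_opNorm⟩

theorem sum_sum_sum_comm {ι κ : Type*} [Fintype ι] (s : Finset κ) (f : ι → ι → κ → ℂ) :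
    ∑ p, ∑ q, ∑ m ∈ s, f p q m = ∑ m ∈ s, ∑ p, ∑ q, f p q m := by
  rw [Finset.sum_comm (s := s)]
  exact Finset.sum_congr rfl fun p _ => Finset.sum_comm

section LoopEquation
variable {n : ℕ}

open scoped Matrix.Norms.Operator in
/-- `f` is continuous and grows at most like the `k`-th power of the norm. The submultiplicative
`ℓ^∞` operator norm on matrices is used. -/
def HasNormGrowth (k : ℕ) (f : Matrix (Fin n) (Fin n) ℂ → ℂ) : Prop :=
  Continuous f ∧ ∃ C, 0 ≤ C ∧ ∀ Y, ‖f Y‖ ≤ C * ‖Y‖ ^ k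

open scoped Matrix.Norms.Operator in
theorem hasNormGrowth_trace_mul_pow (D : Matrix (Fin n) (Fin n) ℂ) (k : ℕ) :
    HasNormGrowth k fun Y => (D * Y ^ k).trace := by
  refine ⟨by fun_prop, ?_⟩
  rcases k with _ | k
  · exact ⟨‖D.trace‖, by positivity, fun Y => by simp⟩
  · obtain ⟨C, hC0, hC⟩ := exists_norm_linearMap_le ((Matrix.traceLinearMap (Fin n) ℝ ℂ).comp
      (LinearMap.mulLeft ℝ D))
    refine ⟨C, hC0, fun Y => (hC (Y ^ (k + 1))).trans ?_⟩
    exact mul_le_mul_of_nonneg_left (norm_pow_le' Y (Nat.succ_pos k)) hC0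

open scoped Matrix.Norms.Operator in
theorem hasNormGrowth_trace_mul_pow_mul_pow (D : Matrix (Fin n) (Fin n) ℂ) (i j : ℕ)
    (hi : 0 < i) (hj : 0 < j) :
    HasNormGrowth (i + j) fun Y => (D * (Y ^ i * D * Y ^ j)).trace := by
  refine ⟨by fun_prop, ?_⟩
  obtain ⟨C, hC0, hC⟩ := exists_norm_linearMap_le ((Matrix.traceLinearMap (Fin n) ℝ ℂ).comp
    (LinearMap.mulLeft ℝ D))
  refine ⟨C * ‖D‖, by positivity, fun Y => (hC (Y ^ i * D * Y ^ j)).trans ?_⟩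
  have h1 : ‖Y ^ i * D * Y ^ j‖ ≤ ‖Y‖ ^ i * ‖D‖ * ‖Y‖ ^ j :=
    (norm_mul_le _ _).trans (mul_le_mul ((norm_mul_le _ _).trans
      (mul_le_mul_of_nonneg_right (norm_pow_le' Y hi) (norm_nonneg _))) (norm_pow_le' Y hj)
      (norm_nonneg _) (by positivity))
  calc C * ‖Y ^ i * D * Y ^ j‖ ≤ C * (‖Y‖ ^ i * ‖D‖ * ‖Y‖ ^ j) :=
        mul_le_mul_of_nonneg_left h1 hC0
    _ = C * ‖D‖ * ‖Y‖ ^ (i + j) := by ring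

open scoped Matrix.Norms.Operator in
theorem HasNormGrowth.mul {j k : ℕ} {f g : Matrix (Fin n) (Fin n) ℂ → ℂ}
    (hf : HasNormGrowth j f) (hg : HasNormGrowth k g) :
    HasNormGrowth (j + k) fun Y => f Y * g Y := by
  obtain ⟨hfc, C, hC0, hC⟩ := hf
  obtain ⟨hgc, C', hC'0, hC'⟩ := hg
  refine ⟨hfc.mul hgc, C * C', by positivity, fun Y => ?_⟩
  rw [norm_mul, pow_add]
  calc ‖f Y‖ * ‖g Y‖ ≤ (C * ‖Y‖ ^ j) * (C' * ‖Y‖ ^ k) :=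
        mul_le_mul (hC Y) (hC' Y) (norm_nonneg _) (by positivity)
    _ = _ := by ring

open scoped Matrix.Norms.Operator in
theorem HasNormGrowth.add {k : ℕ} {f g : Matrix (Fin n) (Fin n) ℂ → ℂ}
    (hf : HasNormGrowth k f) (hg : HasNormGrowth k g) :
    HasNormGrowth k fun Y => f Y + g Y := by
  obtain ⟨hfc, C, hC0, hC⟩ := hf
  obtain ⟨hgc, C', hC'0, hC'⟩ := hg
  refine ⟨hfc.add hgc, C + C', by positivity, fun Y => ?_⟩
  rw [add_mul]
  exact (norm_add_le _ _).trans (add_le_add (hC Y) (hC' Y))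

open scoped Matrix.Norms.Operator in
theorem hasNormGrowth_const (c : ℂ) :
    HasNormGrowth 0 fun _ : Matrix (Fin n) (Fin n) ℂ => c :=
  ⟨continuous_const, ‖c‖, norm_nonneg _, fun Y => by simp⟩

theorem HasNormGrowth.const_mul {k : ℕ} {f : Matrix (Fin n) (Fin n) ℂ → ℂ}
    (hf : HasNormGrowth k f) (c : ℂ) : HasNormGrowth k fun Y => c * f Y := by
  simpa using (hasNormGrowth_const c).mul hf

open scoped Matrix.Norms.Operator in
theorem hasNormGrowth_sum {ι : Type*} (s : Finset ι) {k : ℕ}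
    {f : ι → Matrix (Fin n) (Fin n) ℂ → ℂ} (hf : ∀ i ∈ s, HasNormGrowth k (f i)) :
    HasNormGrowth k fun Y => ∑ i ∈ s, f i Y := by
  classical
  induction s using Finset.induction_on with
  | empty => exact ⟨by simpa using continuous_const, 0, le_rfl, fun Y => by simp⟩
  | insert i s hi ih =>
    simp only [Finset.sum_insert hi]
    exact (hf i (by simp)).add (ih fun j hj => hf j (by simp [hj]))

theorem hasNormGrowth_powerTraceProd (l : List ℕ) :
    HasNormGrowth (n := n) l.sum (powerTraceProd l) := by
  induction l with
  | nil => exact hasNormGrowth_const 1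
  | cons b l ih =>
    have := (hasNormGrowth_trace_mul_pow (n := n) 1 b).mul ih
    simp only [one_mul] at this
    rw [List.sum_cons]
    exact this

theorem laguerreWeight_eq_of_posDef {x : Fin n → Fin n → ℝ} (hx : x ∈ posDefCone n) :
    laguerreWeight (hermitianOfCoords n x) =
      (((hermitianOfCoords n x).det.re ^ n * Real.exp (-∑ i, x i i) : ℝ) : ℂ) := by
  rw [laguerreWeight, (det_eq_ofReal_of_posDef hx).2, trace_hermitianOfCoords]
  push_cast
  simp

open scoped Matrix.Norms.Operator in
/-- An expression of degree `k ≤ n` in the inverse, times the weight, stays bounded near the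
boundary of the cone: the factor `det ^ n` absorbs the `k` poles. -/
theorem norm_mul_laguerreWeight_le {k : ℕ} (hk : k ≤ n) {f : Matrix (Fin n) (Fin n) ℂ → ℂ} {C : ℝ}
    (hf : ∀ Y, ‖f Y‖ ≤ C * ‖Y‖ ^ k) {x : Fin n → Fin n → ℝ} (hx : x ∈ posDefCone n) :
    ‖f (hermitianOfCoords n x)⁻¹ * laguerreWeight (hermitianOfCoords n x)‖ ≤
      C * dominatingKernel n (n - k) k x := by
  have hdet := (det_eq_ofReal_of_posDef hx).1
  rw [laguerreWeight_eq_of_posDef hx, norm_mul, Complex.norm_real,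
    Real.norm_of_nonneg (by positivity), dominatingKernel, norm_adjugate_of_posDef hx,
    abs_of_pos hdet]
  calc _ ≤ C * ‖(hermitianOfCoords n x)⁻¹‖ ^ k *
        ((hermitianOfCoords n x).det.re ^ n * Real.exp (-∑ i, x i i)) :=
        mul_le_mul_of_nonneg_right (hf _) (by positivity)
    _ = _ := by
        rw [← pow_sub_mul_pow _ hk]
        ring

theorem continuousOn_inv_hermitianOfCoords :
    ContinuousOn (fun x => (hermitianOfCoords n x)⁻¹) (posDefCone n) := by
  simp only [Matrix.inv_def]
  have h1 : Continuous fun x => (hermitianOfCoords n x).adjugate :=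
    continuous_hermitianOfCoords.matrix_adjugate
  have h2 : Continuous fun x => (hermitianOfCoords n x).det :=
    continuous_hermitianOfCoords.matrix_det
  simp only [Ring.inverse_eq_inv]
  exact (h2.continuousOn.inv₀ fun x hx => (Matrix.PosDef.det_pos hx).ne').smul h1.continuousOn

theorem continuous_laguerreWeight :
    Continuous fun x => laguerreWeight (hermitianOfCoords n x) := by
  have h2 : Continuous fun x => (hermitianOfCoords n x).det :=
    continuous_hermitianOfCoords.matrix_det
  have h3 : Continuous fun x => (hermitianOfCoords n x).trace :=
    continuous_hermitianOfCoords.matrix_trace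
  unfold laguerreWeight
  fun_prop

theorem HasNormGrowth.integrableOn {k : ℕ} (hk : k ≤ n) {f : Matrix (Fin n) (Fin n) ℂ → ℂ}
    (hf : HasNormGrowth k f) :
    IntegrableOn (fun x => f (hermitianOfCoords n x)⁻¹ * laguerreWeight (hermitianOfCoords n x))
      (posDefCone n) := by
  obtain ⟨hfc, C, hC0, hC⟩ := hf
  refine Integrable.mono' ((integrableOn_dominatingKernel (n - k) k).const_mul C) ?_
    ((ae_restrict_iff' isOpen_posDefCone.measurableSet).2
      (Filter.Eventually.of_forall fun x hx => norm_mul_laguerreWeight_le hk hC hx))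
  exact ContinuousOn.aestronglyMeasurable
    ((hfc.comp_continuousOn continuousOn_inv_hermitianOfCoords).mul
      continuous_laguerreWeight.continuousOn) isOpen_posDefCone.measurableSet

/-- The directional derivative along `D` of `Tr (D Y ^ a) P_μ(Y) w`, divided by the weight `w`. -/
noncomputable def loopIntegrand (a : ℕ) (μ : List ℕ) (D Y : Matrix (Fin n) (Fin n) ℂ) : ℂ :=
  (-∑ m ∈ Finset.range a, (D * (Y ^ (m + 1) * D * Y ^ (a - m))).trace) * powerTraceProd μ Y +
    (D * Y ^ a).trace * (-∑ j : Fin μ.length, (μ[j] : ℂ) * (D * Y ^ (μ[j] + 1)).trace *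
      powerTraceProd (μ.eraseIdx j) Y) +
    (D * Y ^ a).trace * powerTraceProd μ Y * (n * (D * Y).trace - D.trace)

theorem hasLineDerivAt_loop (a : ℕ) (μ : List ℕ) (v : Fin n → Fin n → ℝ) {x : Fin n → Fin n → ℝ}
    (hx : x ∈ posDefCone n) :
    HasLineDerivAt ℝ (fun x => (hermitianOfCoords n v * (hermitianOfCoords n x)⁻¹ ^ a).trace *
        powerTraceProd μ (hermitianOfCoords n x)⁻¹ * laguerreWeight (hermitianOfCoords n x))
      (loopIntegrand a μ (hermitianOfCoords n v) (hermitianOfCoords n x)⁻¹ *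
        laguerreWeight (hermitianOfCoords n x)) x v := by
  have hA : IsUnit (hermitianOfCoords n x) := Matrix.PosDef.isUnit hx
  unfold HasLineDerivAt
  simp only [hermitianOfCoords_add, hermitianOfCoords_smul]
  refine (((hasDerivAt_trace_mul_inv_pow_line hA _ _ a).fun_mul
    (hasDerivAt_powerTraceProd_line hA _ μ)).fun_mul
    (hasDerivAt_laguerreWeight_line hA _)).congr_deriv ?_
  simp only [zero_smul, add_zero, loopIntegrand]
  ring

/-- Summed over the basis, the derivatives recombine into power traces by completeness. -/
theorem sum_loopIntegrand (a : ℕ) (μ : List ℕ) (Y : Matrix (Fin n) (Fin n) ℂ) :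
    ∑ p, ∑ q, (if p = q then (1 : ℂ) else 1 / 2) * loopIntegrand a μ (hermitianBasis p q) Y =
      n * powerTraceProd ((a + 1) :: μ) Y - powerTraceProd (a :: μ) Y -
        cutJoin (fun l => powerTraceProd l Y) ((a + 1) :: μ) := by
  have h1 : ∀ p q, (if p = q then (1 : ℂ) else 1 / 2) * loopIntegrand a μ (hermitianBasis p q) Y =
      -(∑ m ∈ Finset.range a, powerTraceProd μ Y * ((if p = q then (1 : ℂ) else 1 / 2) *
        (hermitianBasis p q * (Y ^ (m + 1) * hermitianBasis p q * Y ^ (a - m))).trace)) -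
      (∑ j : Fin μ.length, (μ[j] : ℂ) * powerTraceProd (μ.eraseIdx j) Y *
        ((if p = q then (1 : ℂ) else 1 / 2) * ((hermitianBasis p q * Y ^ a).trace *
          (hermitianBasis p q * Y ^ (μ[j] + 1)).trace))) +
      n * powerTraceProd μ Y * ((if p = q then (1 : ℂ) else 1 / 2) *
        ((hermitianBasis p q * Y ^ a).trace * (hermitianBasis p q * Y).trace)) -
      powerTraceProd μ Y * ((if p = q then (1 : ℂ) else 1 / 2) *
        ((hermitianBasis p q * Y ^ a).trace * (hermitianBasis p q * 1).trace)) := by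
    intro p q
    rw [loopIntegrand, mul_one, ← Finset.mul_sum, ← Finset.mul_sum]
    have h2 : ∑ j : Fin μ.length, (μ[j] : ℂ) * powerTraceProd (μ.eraseIdx j) Y *
        ((if p = q then (1 : ℂ) else 1 / 2) * ((hermitianBasis p q * Y ^ a).trace *
          (hermitianBasis p q * Y ^ (μ[j] + 1)).trace)) =
        (if p = q then (1 : ℂ) else 1 / 2) * (hermitianBasis p q * Y ^ a).trace *
        ∑ j : Fin μ.length, (μ[j] : ℂ) * (hermitianBasis p q * Y ^ (μ[j] + 1)).trace *
          powerTraceProd (μ.eraseIdx j) Y := by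
      rw [Finset.mul_sum]
      exact Finset.sum_congr rfl fun j _ => by ring
    rw [h2]
    ring
  have h3 : ∑ p : Fin n, ∑ q : Fin n, ∑ m ∈ Finset.range a, powerTraceProd μ Y *
      ((if p = q then (1 : ℂ) else 1 / 2) *
        (hermitianBasis p q * (Y ^ (m + 1) * hermitianBasis p q * Y ^ (a - m))).trace) =
      ∑ m ∈ Finset.range a, powerTraceProd ((m + 1) :: (a - m) :: μ) Y := by
    rw [sum_sum_sum_comm]
    simp only [← Finset.mul_sum (a := powerTraceProd μ Y), sum_trace_mul_mul_mul]
    rw [Finset.mul_sum]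
    refine Finset.sum_congr rfl fun m _ => ?_
    simp only [powerTraceProd, List.map_cons, List.prod_cons]
    ring
  have h4 : ∑ p : Fin n, ∑ q : Fin n, ∑ j : Fin μ.length,
      (μ[j] : ℂ) * powerTraceProd (μ.eraseIdx j) Y *
        ((if p = q then (1 : ℂ) else 1 / 2) * ((hermitianBasis p q * Y ^ a).trace *
          (hermitianBasis p q * Y ^ (μ[j] + 1)).trace)) =
      ∑ j : Fin μ.length, (μ[j] : ℂ) * powerTraceProd ((a + 1 + μ[j]) :: μ.eraseIdx j) Y := by
    rw [sum_sum_sum_comm]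
    refine Finset.sum_congr rfl fun j _ => ?_
    simp only [← Finset.mul_sum, sum_trace_mul_trace, ← pow_add]
    rw [show a + (μ[j] + 1) = a + 1 + μ[j] by ring]
    simp only [powerTraceProd, List.map_cons, List.prod_cons]
    ring
  simp only [h1, Finset.sum_add_distrib, Finset.sum_sub_distrib, Finset.sum_neg_distrib]
  rw [h3, h4]
  simp only [← Finset.mul_sum, sum_trace_mul_trace]
  rw [mul_one, ← pow_succ]
  simp only [cutJoin, powerTraceProd, List.map_cons, List.prod_cons]
  ring

open scoped Matrix.Norms.Operator in
/-- The test function `Tr (D Y ^ a) P_μ(Y) w` has degree at most `n - 1` in the inverse `Y`, so it is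
`O(det)` at the boundary of the cone and the divergence theorem applies. -/
theorem integrableOn_loopIntegrand_and_integral_eq_zero (a : ℕ) (μ : List ℕ) (h : a + 1 + μ.sum ≤ n)
    (v : Fin n → Fin n → ℝ) :
    IntegrableOn (fun x => loopIntegrand a μ (hermitianOfCoords n v) (hermitianOfCoords n x)⁻¹ *
        laguerreWeight (hermitianOfCoords n x)) (posDefCone n) ∧
      ∫ x in posDefCone n, loopIntegrand a μ (hermitianOfCoords n v) (hermitianOfCoords n x)⁻¹ *
        laguerreWeight (hermitianOfCoords n x) = 0 := by
  have hint : IntegrableOn (fun x => loopIntegrand a μ (hermitianOfCoords n v)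
      (hermitianOfCoords n x)⁻¹ * laguerreWeight (hermitianOfCoords n x)) (posDefCone n) := by
    set D := hermitianOfCoords n v
    have hP := hasNormGrowth_powerTraceProd (n := n) μ
    have hT := hasNormGrowth_trace_mul_pow D a
    have g1 : HasNormGrowth (a + 1 + μ.sum) fun Y =>
        (-1 * ∑ m ∈ Finset.range a, (D * (Y ^ (m + 1) * D * Y ^ (a - m))).trace) *
          powerTraceProd μ Y := by
      refine (HasNormGrowth.const_mul (hasNormGrowth_sum _ fun m hm => ?_) (-1)).mul hP
      have hm' := Finset.mem_range.1 hm
      have := hasNormGrowth_trace_mul_pow_mul_pow D (m + 1) (a - m) (by omega) (by omega)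
      rwa [show m + 1 + (a - m) = a + 1 by omega] at this
    have g2 : HasNormGrowth (a + 1 + μ.sum) fun Y => (D * Y ^ a).trace *
        (-1 * ∑ j : Fin μ.length, (μ[j] : ℂ) * ((D * Y ^ (μ[j] + 1)).trace *
          powerTraceProd (μ.eraseIdx j) Y)) := by
      rw [add_assoc]
      refine hT.mul (HasNormGrowth.const_mul (hasNormGrowth_sum _ fun j _ => ?_) (-1))
      have := ((hasNormGrowth_trace_mul_pow D (μ[j] + 1)).mul
        (hasNormGrowth_powerTraceProd (μ.eraseIdx j))).const_mul (μ[j] : ℂ)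
      have hs := sum_eraseIdx_add_getElem μ j j.2
      rwa [show μ[j] + 1 + (μ.eraseIdx j).sum = 1 + μ.sum by
        rw [← hs]; simp only [Fin.getElem_fin]; ring] at this
    have g3 : HasNormGrowth (a + 1 + μ.sum) fun Y =>
        ((D * Y ^ a).trace * powerTraceProd μ Y) * (n * (D * Y ^ 1).trace) := by
      have := (hT.mul hP).mul ((hasNormGrowth_trace_mul_pow D 1).const_mul n)
      rwa [add_right_comm] at this
    -- The term from differentiating `exp (-Tr)` has one degree less than the others.
    have g4 : HasNormGrowth (a + μ.sum) fun Y =>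
        -D.trace * ((D * Y ^ a).trace * powerTraceProd μ Y) := (hT.mul hP).const_mul _
    refine ((((g1.add g2).add g3).integrableOn h).add (g4.integrableOn (by omega))).congr
      (Filter.Eventually.of_forall fun x => ?_)
    simp only [loopIntegrand, pow_one, Pi.add_apply, mul_assoc]
    ring
  refine ⟨hint, ?_⟩
  set u : (Fin n → Fin n → ℝ) → ℝ := fun x => (hermitianOfCoords n x).det.re with hu
  have hud : ContDiff ℝ 1 u := contDiff_det_hermitianOfCoords
  have hG := (hasNormGrowth_trace_mul_pow (hermitianOfCoords n v) a).mul
    (hasNormGrowth_powerTraceProd (n := n) μ)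
  obtain ⟨C, hC0, hC⟩ := hG.2
  obtain ⟨-, C', hC'0, hC'⟩ := hasNormGrowth_trace_mul_pow (hermitianOfCoords n v) 1
  set k := a + μ.sum with hk
  -- By Jacobi's formula the derivative of the determinant is `Tr (D * adjugate)`, so multiplying by
  -- it turns one spare power of the determinant into one of the adjugate.
  have hu' : ∀ x ∈ posDefCone n,
      |fderiv ℝ u x v| ≤ C' * ‖(hermitianOfCoords n x).adjugate‖ := by
    intro x hx
    have h1 : HasLineDerivAt ℝ u (fderiv ℝ u x v) x v :=
      (hud.differentiable one_ne_zero x).hasFDerivAt.hasLineDerivAt v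
    have h2 : HasLineDerivAt ℝ u ((hermitianOfCoords n x).det *
        (hermitianOfCoords n v * (hermitianOfCoords n x)⁻¹).trace).re x v := by
      have := hasDerivAt_det_line (Matrix.PosDef.isUnit hx) (hermitianOfCoords n v)
      have h3 := Complex.reCLM.hasFDerivAt.comp_hasDerivAt (0 : ℝ) this
      unfold HasLineDerivAt
      simp only [hu, hermitianOfCoords_add, hermitianOfCoords_smul]
      exact h3
    rw [HasDerivAt.unique h1 h2]
    refine (Complex.abs_re_le_norm _).trans ?_
    have hdet := det_eq_ofReal_of_posDef hx
    rw [norm_mul, norm_adjugate_of_posDef hx]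
    have h4 := hC' (hermitianOfCoords n x)⁻¹
    simp only [pow_one] at h4
    calc ‖(hermitianOfCoords n x).det‖ * _ ≤
          (hermitianOfCoords n x).det.re * (C' * ‖(hermitianOfCoords n x)⁻¹‖) := by
          refine mul_le_mul (le_of_eq ?_) h4 (norm_nonneg _) hdet.1.le
          rw [hdet.2, Complex.norm_real, Real.norm_of_nonneg hdet.1.le, Complex.ofReal_re]
      _ = _ := by ring
  refine setIntegral_lineDeriv_eq_zero isOpen_posDefCone (u := u) (u' := fun x => fderiv ℝ u x v)
    (B := fun x => C * dominatingKernel n (n - k - 1) k x) (v := v)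
    (fun x => (hud.differentiable one_ne_zero x).hasFDerivAt.hasLineDerivAt v) hud.continuous
    ((hud.continuous_fderiv one_ne_zero).clm_apply continuous_const)
    ((continuous_dominatingKernel _ _).const_mul C)
    (fun x hx => (det_eq_ofReal_of_posDef hx).1) (fun x hx => det_re_eq_zero_of_mem_frontier hx)
    (fun x hx => hasLineDerivAt_loop a μ v hx) (fun x hx => ?_)
    (hG.integrableOn (by omega)) hint ?_
  · refine (norm_mul_laguerreWeight_le (by omega) hC hx).trans (le_of_eq ?_)
    rw [dominatingKernel, dominatingKernel, show n - k = n - k - 1 + 1 by omega, pow_succ,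
      abs_of_pos (det_eq_ofReal_of_posDef hx).1, Nat.add_sub_cancel]
    ring
  · refine ((integrableOn_dominatingKernel (n - k - 1) (k + 1)).const_mul (C * C')).mono' ?_
      ((ae_restrict_iff' isOpen_posDefCone.measurableSet).2
        (Filter.Eventually.of_forall fun x hx => ?_))
    · have h1 := continuous_dominatingKernel (n := n) (n - k - 1) k
      have h2 : Continuous fun x => fderiv ℝ u x v :=
        (hud.continuous_fderiv one_ne_zero).clm_apply continuous_const
      exact ((h1.const_mul C).mul h2.abs).aestronglyMeasurable
    · have h0 := dominatingKernel_nonneg (n - k - 1) k x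
      rw [Real.norm_of_nonneg (by positivity)]
      calc C * dominatingKernel n (n - k - 1) k x * |fderiv ℝ u x v| ≤
            C * dominatingKernel n (n - k - 1) k x *
              (C' * ‖(hermitianOfCoords n x).adjugate‖) :=
            mul_le_mul_of_nonneg_left (hu' x hx) (by positivity)
        _ = _ := by rw [dominatingKernel, dominatingKernel]; ring

/-- The unnormalised mixed moment `∫ ∏ b ∈ l, Tr X ^ (-b)` against the Laguerre weight. -/
noncomputable def inverseMoment (n : ℕ) (l : List ℕ) : ℂ :=
  ∫ x in posDefCone n, powerTraceProd l (hermitianOfCoords n x)⁻¹ *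
    laguerreWeight (hermitianOfCoords n x)

theorem integrableOn_powerTraceProd {l : List ℕ} (hl : l.sum ≤ n) :
    IntegrableOn (fun x => powerTraceProd l (hermitianOfCoords n x)⁻¹ *
      laguerreWeight (hermitianOfCoords n x)) (posDefCone n) :=
  (hasNormGrowth_powerTraceProd l).integrableOn hl

theorem inverseMoment_zero_cons (μ : List ℕ) :
    inverseMoment n (0 :: μ) = n * inverseMoment n μ := by
  simp [inverseMoment, powerTraceProd, ← integral_const_mul, mul_assoc]

/-- The loop (Schwinger–Dyson) equation, obtained by integrating the divergence of
`Y ^ a • P_μ(Y) • w` over the cone. -/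
theorem inverseMoment_loop (a : ℕ) (μ : List ℕ) (h : a + 1 + μ.sum ≤ n) :
    n * inverseMoment n ((a + 1) :: μ) =
      inverseMoment n (a :: μ) + cutJoin (inverseMoment n) ((a + 1) :: μ) := by
  have hcut : ∀ m ∈ Finset.range a, ((m + 1) :: (a - m) :: μ).sum ≤ n := by
    intro m hm
    have := Finset.mem_range.1 hm
    simp only [List.sum_cons]
    omega
  have hjoin : ∀ j : Fin μ.length, ((a + 1 + μ[j]) :: μ.eraseIdx j).sum ≤ n := by
    intro j
    have := sum_eraseIdx_add_getElem μ j j.2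
    simp only [List.sum_cons, Fin.getElem_fin]
    omega
  have hsum : ∫ x in posDefCone n, (∑ p, ∑ q, (if p = q then (1 : ℂ) else 1 / 2) *
      (loopIntegrand a μ (hermitianBasis p q) (hermitianOfCoords n x)⁻¹ *
        laguerreWeight (hermitianOfCoords n x))) = 0 := by
    have hi : ∀ p q : Fin n, IntegrableOn (fun x => loopIntegrand a μ (hermitianBasis p q)
          (hermitianOfCoords n x)⁻¹ * laguerreWeight (hermitianOfCoords n x)) (posDefCone n) ∧
        ∫ x in posDefCone n, loopIntegrand a μ (hermitianBasis p q) (hermitianOfCoords n x)⁻¹ *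
          laguerreWeight (hermitianOfCoords n x) = 0 := fun p q =>
      integrableOn_loopIntegrand_and_integral_eq_zero a μ h (Pi.single p (Pi.single q 1))
    rw [integral_finsetSum _ fun p _ => integrable_finsetSum _ fun q _ => (hi p q).1.const_mul _]
    refine Finset.sum_eq_zero fun p _ => ?_
    rw [integral_finsetSum _ fun q _ => (hi p q).1.const_mul _]
    refine Finset.sum_eq_zero fun q _ => ?_
    rw [integral_const_mul]
    exact mul_eq_zero_of_right _ (hi p q).2
  have hint1 := (integrableOn_powerTraceProd (n := n) (l := (a + 1) :: μ)
    (by simpa using h)).const_mul (n : ℂ)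
  have hint2 := integrableOn_powerTraceProd (n := n) (l := a :: μ)
    (by simp only [List.sum_cons]; omega)
  have hint3 := integrable_finsetSum (Finset.range a) fun m hm =>
    integrableOn_powerTraceProd (hcut m hm)
  have hint4 := integrable_finsetSum Finset.univ fun j (_ : j ∈ Finset.univ) =>
    (integrableOn_powerTraceProd (hjoin j)).const_mul (μ[j] : ℂ)
  have hexp : ∀ x, (∑ p, ∑ q, (if p = q then (1 : ℂ) else 1 / 2) *
      (loopIntegrand a μ (hermitianBasis p q) (hermitianOfCoords n x)⁻¹ *
        laguerreWeight (hermitianOfCoords n x))) =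
      n * (powerTraceProd ((a + 1) :: μ) (hermitianOfCoords n x)⁻¹ *
        laguerreWeight (hermitianOfCoords n x)) -
      powerTraceProd (a :: μ) (hermitianOfCoords n x)⁻¹ *
        laguerreWeight (hermitianOfCoords n x) -
      (∑ m ∈ Finset.range a, powerTraceProd ((m + 1) :: (a - m) :: μ) (hermitianOfCoords n x)⁻¹ *
          laguerreWeight (hermitianOfCoords n x) +
        ∑ j : Fin μ.length, (μ[j] : ℂ) * (powerTraceProd ((a + 1 + μ[j]) :: μ.eraseIdx j)
          (hermitianOfCoords n x)⁻¹ * laguerreWeight (hermitianOfCoords n x))) := by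
    intro x
    simp only [← mul_assoc, ← Finset.sum_mul, sum_loopIntegrand, cutJoin]
    ring
  simp only [hexp] at hsum
  have key : ∀ F₁ F₂ F₃ F₄ : (Fin n → Fin n → ℝ) → ℂ, IntegrableOn F₁ (posDefCone n) →
      IntegrableOn F₂ (posDefCone n) → IntegrableOn F₃ (posDefCone n) →
      IntegrableOn F₄ (posDefCone n) → ∫ x in posDefCone n, (F₁ x - F₂ x - (F₃ x + F₄ x)) =
        (∫ x in posDefCone n, F₁ x) - (∫ x in posDefCone n, F₂ x) -
          ((∫ x in posDefCone n, F₃ x) + ∫ x in posDefCone n, F₄ x) := by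
    intro F₁ F₂ F₃ F₄ h₁ h₂ h₃ h₄
    have h₁₂ : IntegrableOn (fun x => F₁ x - F₂ x) (posDefCone n) := h₁.sub h₂
    have h₃₄ : IntegrableOn (fun x => F₃ x + F₄ x) (posDefCone n) := h₃.add h₄
    rw [integral_sub h₁₂ h₃₄, integral_sub h₁ h₂, integral_add h₃ h₄]
  rw [key _ _ _ _ hint1 hint2 hint3 hint4, integral_const_mul,
    integral_finsetSum _ fun m hm => integrableOn_powerTraceProd (hcut m hm),
    integral_finsetSum _ fun j _ => (integrableOn_powerTraceProd (hjoin j)).const_mul _] at hsum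
  simp only [integral_const_mul] at hsum
  simp only [cutJoin, inverseMoment]
  linear_combination hsum

end LoopEquation

/-! ### Expectations under the Laguerre ensemble -/

section Ensemble
variable {n : ℕ}

instance complexMatrixBorelSpace (n : ℕ) : BorelSpace (Matrix (Fin n) (Fin n) ℂ) :=
  inferInstanceAs (BorelSpace (Fin n → Fin n → ℂ))

theorem measurable_lueDensity (n α : ℕ) : Measurable fun X : Matrix (Fin n) (Fin n) ℂ =>
    ENNReal.ofReal (X.det.re ^ α * Real.exp (-X.trace.re)) := by
  have h1 : Continuous fun X : Matrix (Fin n) (Fin n) ℂ => X.det :=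
    continuous_id.matrix_det
  have h2 : Continuous fun X : Matrix (Fin n) (Fin n) ℂ => X.trace :=
    continuous_id.matrix_trace
  have h3 : Continuous fun X : Matrix (Fin n) (Fin n) ℂ =>
    X.det.re ^ α * Real.exp (-X.trace.re) := by fun_prop
  exact ENNReal.measurable_ofReal.comp h3.measurable

theorem measurable_inversePowerTrace (n k : ℕ) : Measurable (inversePowerTrace n k) := by
  have h1 : Measurable fun X : Matrix (Fin n) (Fin n) ℂ => X⁻¹ := by
    have hd : Measurable fun X : Matrix (Fin n) (Fin n) ℂ => X.det :=
      (continuous_id.matrix_det).measurable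
    have ha : Continuous fun X : Matrix (Fin n) (Fin n) ℂ => X.adjugate :=
      continuous_id.matrix_adjugate
    simp only [Matrix.inv_def, Ring.inverse_eq_inv]
    refine measurable_pi_lambda _ fun i => measurable_pi_lambda _ fun j => ?_
    exact hd.inv.mul ((ha.matrix_elem i j).measurable)
  have h2 : Continuous fun Y : Matrix (Fin n) (Fin n) ℂ =>
      (n : ℝ) ^ ((k : ℤ) - 1) * ((Y ^ k).trace).re := by fun_prop
  exact h2.measurable.comp h1

theorem measurableSet_posSemidef :
    MeasurableSet {X : Matrix (Fin n) (Fin n) ℂ | X.PosSemidef} :=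
  isClosed_posSemidef.measurableSet

/-- The part of the cone outside the positive definite matrices carries no mass: the
determinant vanishes there, and its exponent is at least one. -/
theorem lueDensity_toReal_eq_zero (hn : 1 ≤ n) {x : Fin n → Fin n → ℝ}
    (hx : (hermitianOfCoords n x).PosSemidef) (hx' : x ∉ posDefCone n) :
    (ENNReal.ofReal ((hermitianOfCoords n x).det.re ^ n *
      Real.exp (-(hermitianOfCoords n x).trace.re))).toReal = 0 := by
  rw [det_eq_zero_of_posSemidef_of_not_posDef hx hx']
  simp [show n ≠ 0 by omega]

theorem posDefCone_subset : posDefCone n ⊆ hermitianOfCoords n ⁻¹' {X | X.PosSemidef} :=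
  fun _ hx => Matrix.PosDef.posSemidef hx

theorem lueDensity_toReal {x : Fin n → Fin n → ℝ} (hx : x ∈ posDefCone n) :
    (((ENNReal.ofReal ((hermitianOfCoords n x).det.re ^ n *
      Real.exp (-(hermitianOfCoords n x).trace.re))).toReal : ℝ) : ℂ) =
      laguerreWeight (hermitianOfCoords n x) := by
  have := (det_eq_ofReal_of_posDef hx).1
  rw [laguerreWeight_eq_of_posDef hx, ENNReal.toReal_ofReal (by positivity),
    trace_hermitianOfCoords, Complex.ofReal_re]

/-- Integrals against the Laguerre weight, written in coordinates over the positive definite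
cone. -/
theorem integral_lueWeight (hn : 1 ≤ n) {f : Matrix (Fin n) (Fin n) ℂ → ℝ} (hf : Measurable f) :
    ((∫ X, f X ∂lueWeight n n : ℝ) : ℂ) = ∫ x in posDefCone n, (f (hermitianOfCoords n x) : ℂ) *
      laguerreWeight (hermitianOfCoords n x) := by
  have hd := measurable_lueDensity n n
  rw [lueWeight, integral_withDensity_eq_integral_toReal_smul hd
    (Filter.Eventually.of_forall fun _ => ENNReal.ofReal_lt_top), hermitianLebesgue,
    setIntegral_map measurableSet_posSemidef
      (f := fun X => (ENNReal.ofReal (X.det.re ^ n * Real.exp (-X.trace.re))).toReal • f X)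
      (hd.ennreal_toReal.smul hf).aestronglyMeasurable
      (measurable_hermitianOfCoords n).aemeasurable,
    setIntegral_eq_of_subset_of_forall_sdiff_eq_zero
      (measurableSet_posSemidef.preimage (measurable_hermitianOfCoords n)) posDefCone_subset
      (fun x hx => by rw [lueDensity_toReal_eq_zero hn hx.1 hx.2, zero_smul]),
    ← integral_complex_ofReal]
  refine setIntegral_congr_fun isOpen_posDefCone.measurableSet fun x hx => ?_
  simp only [smul_eq_mul, Complex.ofReal_mul]
  rw [lueDensity_toReal hx, mul_comm]

theorem integrable_lueWeight (hn : 1 ≤ n) {f : Matrix (Fin n) (Fin n) ℂ → ℝ} (hf : Measurable f)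
    (hi : IntegrableOn (fun x => (f (hermitianOfCoords n x) : ℂ) *
      laguerreWeight (hermitianOfCoords n x)) (posDefCone n)) : Integrable f (lueWeight n n) := by
  have hd := measurable_lueDensity n n
  rw [lueWeight, integrable_withDensity_iff_integrable_smul' hd
    (Filter.Eventually.of_forall fun _ => ENNReal.ofReal_lt_top), hermitianLebesgue]
  rw [Measure.restrict_map (measurable_hermitianOfCoords n) measurableSet_posSemidef,
    integrable_map_measure
      (g := fun X => (ENNReal.ofReal (X.det.re ^ n * Real.exp (-X.trace.re))).toReal • f X)
      (hd.ennreal_toReal.smul hf).aestronglyMeasurable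
      (measurable_hermitianOfCoords n).aemeasurable]
  refine IntegrableOn.of_forall_sdiff_eq_zero (s := posDefCone n) ?_
    (measurableSet_posSemidef.preimage (measurable_hermitianOfCoords n))
    (fun x hx => ?_)
  · refine (integrableOn_congr_fun (fun x hx => ?_) isOpen_posDefCone.measurableSet).1 hi.re
    simp only [Function.comp_apply, smul_eq_mul]
    rw [← lueDensity_toReal hx, ← Complex.ofReal_mul, mul_comm]
    rfl
  · simp only [Function.comp_apply, smul_eq_mul]
    rw [lueDensity_toReal_eq_zero hn hx.1 hx.2, zero_mul]

theorem one_mem_posDefCone : (fun i j => if i = j then 1 else 0) ∈ posDefCone n := by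
  have : hermitianOfCoords n (fun i j => if i = j then 1 else 0) = 1 := by
    ext i j
    rcases lt_trichotomy i j with h | rfl | h
    · simp [hermitianOfCoords, h, h.ne, h.ne', Complex.ext_iff]
    · simp [hermitianOfCoords, Complex.ext_iff]
    · simp [hermitianOfCoords, h, h.not_gt, h.ne, h.ne', Complex.ext_iff]
  change (hermitianOfCoords n _).PosDef
  rw [this]
  exact Matrix.PosDef.one

theorem inverseMoment_nil_pos (n : ℕ) : ∃ z : ℝ, 0 < z ∧ inverseMoment n [] = z := by
  refine ⟨∫ x in posDefCone n, (hermitianOfCoords n x).det.re ^ n * Real.exp (-∑ i, x i i), ?_, ?_⟩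
  · have hc : Continuous fun x : Fin n → Fin n → ℝ =>
        (hermitianOfCoords n x).det.re ^ n * Real.exp (-∑ i, x i i) := by
      have := continuous_det_re (n := n)
      fun_prop
    have hpos : ∀ x ∈ posDefCone n,
        0 < (hermitianOfCoords n x).det.re ^ n * Real.exp (-∑ i, x i i) := fun x hx => by
      have := (det_eq_ofReal_of_posDef hx).1
      positivity
    rw [setIntegral_pos_iff_support_of_nonneg_ae]
    · rw [Set.inter_eq_self_of_subset_right
        (fun x hx => Function.mem_support.2 (hpos x hx).ne')]
      exact isOpen_posDefCone.measure_pos _ ⟨_, one_mem_posDefCone⟩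
    · exact (ae_restrict_iff' isOpen_posDefCone.measurableSet).2
        (Filter.Eventually.of_forall fun x hx => (hpos x hx).le)
    · refine (integrableOn_congr_fun (fun x hx => ?_) isOpen_posDefCone.measurableSet).1
        (integrableOn_dominatingKernel (n := n) n 0)
      rw [dominatingKernel, abs_of_pos (det_eq_ofReal_of_posDef hx).1, pow_zero, mul_one]
  · rw [inverseMoment, ← integral_complex_ofReal]
    refine setIntegral_congr_fun isOpen_posDefCone.measurableSet fun x hx => ?_
    simp [powerTraceProd, laguerreWeight_eq_of_posDef hx]

theorem lueWeight_univ_toReal (hn : 1 ≤ n) :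
    ((lueWeight n n Set.univ).toReal : ℂ) = inverseMoment n [] ∧ lueWeight n n Set.univ ≠ ⊤ := by
  constructor
  · have := integral_lueWeight hn (f := fun _ => 1) measurable_const
    simpa [inverseMoment, powerTraceProd, Measure.real] using this
  · have h1 : IntegrableOn (fun x => (((1 : ℝ)) : ℂ) * laguerreWeight (hermitianOfCoords n x))
        (posDefCone n) := by
      simpa [powerTraceProd] using integrableOn_powerTraceProd (n := n) (l := []) (by simp)
    have h2 := integrable_lueWeight hn (f := fun _ => 1) measurable_const h1
    exact ((integrable_const_iff.1 h2).resolve_left one_ne_zero).measure_univ_lt_top.ne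

theorem ofReal_inversePowerTrace_mul_weight {k : ℕ} {x : Fin n → Fin n → ℝ} (hx : x ∈ posDefCone n) :
    (inversePowerTrace n k (hermitianOfCoords n x) : ℂ) * laguerreWeight (hermitianOfCoords n x) =
      (((n : ℝ) ^ ((k : ℤ) - 1) * (powerTraceProd [k] (hermitianOfCoords n x)⁻¹ *
        laguerreWeight (hermitianOfCoords n x)).re : ℝ) : ℂ) := by
  rw [laguerreWeight_eq_of_posDef hx, Complex.re_mul_ofReal, ← Complex.ofReal_mul,
    inversePowerTrace, powerTraceProd]
  simp [mul_assoc]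

theorem integrable_inversePowerTrace (hn : 1 ≤ n) {k : ℕ} (hk : k ≤ n) :
    Integrable (inversePowerTrace n k) (lueWeight n n) := by
  refine integrable_lueWeight hn (measurable_inversePowerTrace n k) ?_
  have h := integrableOn_powerTraceProd (n := n) (l := [k]) (by simpa using hk)
  have h' : IntegrableOn (fun x => (((n : ℝ) ^ ((k : ℤ) - 1) *
      (powerTraceProd [k] (hermitianOfCoords n x)⁻¹ *
        laguerreWeight (hermitianOfCoords n x)).re : ℝ) : ℂ)) (posDefCone n) :=
    (h.re.const_mul ((n : ℝ) ^ ((k : ℤ) - 1))).ofReal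
  refine (integrableOn_congr_fun (fun x hx => ?_) isOpen_posDefCone.measurableSet).1 h'
  exact (ofReal_inversePowerTrace_mul_weight hx).symm

theorem integral_inversePowerTrace_lueWeight (hn : 1 ≤ n) {k : ℕ} (hk : k ≤ n) :
    ∫ X, inversePowerTrace n k X ∂lueWeight n n =
      (n : ℝ) ^ ((k : ℤ) - 1) * (inverseMoment n [k]).re := by
  have h := integrableOn_powerTraceProd (n := n) (l := [k]) (by simpa using hk)
  have h1 := integral_lueWeight hn (measurable_inversePowerTrace n k)
  rw [setIntegral_congr_fun isOpen_posDefCone.measurableSet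
    fun x hx => ofReal_inversePowerTrace_mul_weight hx, integral_complex_ofReal,
    integral_const_mul] at h1
  rw [Complex.ofReal_injective h1, inverseMoment]
  congr 1
  exact integral_re h

/-- The expectation of `∏ b ∈ l, Tr X ^ (-b)` under the Laguerre ensemble with parameter `n`. The
real part discards nothing, since the integrand is real on the cone. -/
noncomputable def meanPowerTraceProd (n : ℕ) (l : List ℕ) : ℝ :=
  (inverseMoment n l).re * ((inverseMoment n []).re)⁻¹

theorem lue_inversePowerTrace (hn : 1 ≤ n) {k : ℕ} (hk : k ≤ n) :
    Integrable (inversePowerTrace n k) (LUE n n) ∧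
      ∫ X, inversePowerTrace n k X ∂(LUE n n) =
        (n : ℝ) ^ ((k : ℤ) - 1) * meanPowerTraceProd n [k] := by
  obtain ⟨z, hz, hz'⟩ := inverseMoment_nil_pos n
  obtain ⟨h1, -⟩ := lueWeight_univ_toReal hn
  have h2 : (lueWeight n n Set.univ).toReal = z := by exact_mod_cast h1.trans hz'
  have h3 : lueWeight n n Set.univ ≠ 0 := fun h => by simp [h] at h2; exact hz.ne h2
  refine ⟨(integrable_inversePowerTrace hn hk).smul_measure (ENNReal.inv_ne_top.2 h3), ?_⟩
  rw [LUE, integral_smul_measure, integral_inversePowerTrace_lueWeight hn hk, ENNReal.toReal_inv,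
    h2, meanPowerTraceProd, hz', Complex.ofReal_re, smul_eq_mul]
  ring

theorem meanPowerTraceProd_nil (n : ℕ) : meanPowerTraceProd n [] = 1 := by
  obtain ⟨z, hz, hz'⟩ := inverseMoment_nil_pos n
  rw [meanPowerTraceProd, hz', Complex.ofReal_re, mul_inv_cancel₀ hz.ne']

theorem meanPowerTraceProd_zero_cons (μ : List ℕ) :
    meanPowerTraceProd n (0 :: μ) = n * meanPowerTraceProd n μ := by
  rw [meanPowerTraceProd, inverseMoment_zero_cons, meanPowerTraceProd, ← Complex.ofReal_natCast,
    Complex.re_ofReal_mul]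
  ring

/-- The loop equation for expectations: the real part and the normalisation are additive, so they
commute with the cut-and-join operator. -/
theorem meanPowerTraceProd_loop (a : ℕ) (μ : List ℕ) (h : a + 1 + μ.sum ≤ n) :
    n * meanPowerTraceProd n ((a + 1) :: μ) =
      meanPowerTraceProd n (a :: μ) + cutJoin (meanPowerTraceProd n) ((a + 1) :: μ) := by
  have h1 := map_cutJoin ((AddMonoidHom.mulRight ((inverseMoment n []).re)⁻¹).comp
    Complex.reAddGroupHom) (inverseMoment n) ((a + 1) :: μ)
  have h2 := congrArg Complex.re (inverseMoment_loop a μ h)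
  rw [← Complex.ofReal_natCast, Complex.re_ofReal_mul, Complex.add_re] at h2
  change _ = cutJoin (meanPowerTraceProd n) _ at h1
  rw [← h1]
  simp only [meanPowerTraceProd, AddMonoidHom.comp_apply, AddMonoidHom.mulRight_apply,
    Complex.coe_reAddGroupHom]
  rw [← mul_assoc, h2]
  ring

end Ensemble

/-! ### The genus expansion -/

theorem mainTheorem2 (k : ℕ) :
    ∃ κ : ℕ → ℕ,
      (∀ n : ℕ, 1 ≤ n → k ≤ n →
        Integrable (inversePowerTrace n k) (LUE n n) ∧
        HasSum (fun g : ℕ => (κ g : ℝ) * ((n : ℝ)⁻¹) ^ g)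
          (∫ X, inversePowerTrace n k X ∂(LUE n n))) ∧
      (∀ g : ℕ, Odd g → κ g = 0) ∧
      (2 ≤ k → ∀ g : ℕ, Even g → 0 < κ g) ∧
      (k ≤ 1 → κ 0 = 1 ∧ ∀ g : ℕ, 1 ≤ g → κ g = 0) := by
  rcases k with _ | k
  · refine ⟨fun g => if g = 0 then 1 else 0, fun n hn hk => ?_, fun g hg => ?_, by omega,
      fun _ => ⟨rfl, fun g hg => if_neg (by omega)⟩⟩
    · obtain ⟨h1, h2⟩ := lue_inversePowerTrace hn hk
      refine ⟨h1, ?_⟩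
      have hn0 : (n : ℝ) ≠ 0 := by positivity
      rw [h2, meanPowerTraceProd_zero_cons, meanPowerTraceProd_nil]
      convert hasSum_ite_eq (0 : ℕ) (1 : ℝ) using 1
      · ext g
        by_cases hg : g = 0 <;> simp [hg]
      · simp [hn0]
    · exact if_neg (by rintro rfl; simp at hg)
  · have hcomp : IsCompositionOf (k + 1) [k + 1] := by simp [IsCompositionOf]
    refine ⟨fun g => genusCoeff (k + 1) (g + k) [k + 1], fun n hn hk => ?_, fun g hg => ?_,
      fun hk g hg => ?_, fun hk => ?_⟩
    · obtain ⟨h1, h2⟩ := lue_inversePowerTrace hn hk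
      refine ⟨h1, ?_⟩
      have hn0 : (n : ℝ) ≠ 0 := by positivity
      have h3 := hasSum_genusCoeff (W := meanPowerTraceProd n) (meanPowerTraceProd_nil n)
        (fun a μ h => by
          rw [meanPowerTraceProd_loop a μ h]
          rcases a with _ | a
          · simp [meanPowerTraceProd_zero_cons]
          · simp) (k + 1) hk _ hcomp
      -- The coefficients of `n⁻¹ ^ g` with `g < k` vanish, so the factor `n ^ k` shifts the series.
      have h4 := ((hasSum_nat_add_iff' k).2 h3).mul_left ((n : ℝ) ^ k)
      rw [Finset.sum_eq_zero (s := Finset.range k), sub_zero] at h4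
      · rw [h2]
        have hz : (n : ℝ) ^ (((k + 1 : ℕ) : ℤ) - 1) = (n : ℝ) ^ k := by simp
        rw [hz]
        refine h4.congr_fun fun g => ?_
        rw [pow_add, mul_comm ((n : ℝ) ^ k), mul_assoc, mul_assoc, ← mul_pow,
          inv_mul_cancel₀ hn0, one_pow, mul_one]
      · intro g hg
        have : genusCoeff (k + 1) g [k + 1] = 0 := by
          by_contra hne
          obtain ⟨h, hh⟩ := genusCoeff_ne_zero _ _ _ hcomp hne
          have := Finset.mem_range.1 hg
          simp at hh
          omega
        simp [this]
    · by_contra hne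
      obtain ⟨h, hh⟩ := genusCoeff_ne_zero _ _ _ hcomp hne
      obtain ⟨m, rfl⟩ := hg
      simp at hh
      omega
    · obtain ⟨k, rfl⟩ : ∃ k', k = k' + 1 := ⟨k - 1, by omega⟩
      obtain ⟨m, rfl⟩ := hg
      rw [← two_mul]
      exact genusCoeff_single_pos k m
    · obtain rfl : k = 0 := by omega
      refine ⟨genusCoeff_one_one 0, fun g hg => ?_⟩
      exact (genusCoeff_one_one g).trans (if_neg (by omega))
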